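/- Let $\omega=e^{2\pi i/3}$. For $a,b\in\mathbb F_3^n$ let $X(a)|x\rangle=|x+a\rangle$ and $Z(b)|x\rangle=\omega^{b\cdot x}|x\rangle$ on $(\mathbb C^3)^{\otimes n}$, let $\mathcal E_n=\{\omega^iX(a)Z(b)\}$ be the Pauli group on $n$ qutrits, and let $\mathrm{wt}(\omega^iX(a)Z(b))=\#\{j:(a_j,b_j)\ne(0,0)\}$. For a subgroup $S\le\mathcal E_n$ let $N(S)$ be the group of elements of $\mathcal E_n$ that commute with every element of $S$, and let $S_I=S\cap N(S)$. A code space with orthogonal projector $P$ detects an operator $E$ if $PEP=zP$ for some $z\in\mathbb C$. A stabilizer is an abelian subgroup of a Pauli group whose only scalar element is $I$. A stabilizer $S^b\le\mathcal E_m$ stabilizes an $[[m,k_b,d_b]]_3$ code if $|S^b|=3^{m-k_b}$, the least weight of an element of $N(S^b)\setminus\langle\omega I\rangle S^b$ is $d_b$, and the joint $+1$ eigenspace of $S^b$ has dimension $3^{k_b}$ and detects all Pauli errors of weight less than $d_b$. A subgroup $S\le\mathcal E_n$ EA-stabilizes an $[[n,k,d;c]]_3$ entanglement-assisted code if the following hold.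 * Modulo scalars, $|S_I|=3^l$ and $|S|=3^{l+2c}$, where $l=n-k-c\ge 0$. * The least weight of an element of $N(S)\setminus\langle\omega I\rangle S_I$ is $d$. * There is a stabilizer $\tilde S\le\mathcal E_{n+c}$, acting on the $n$ qutrits of the sender and on $c$ qutrits of the receiver, whose restriction to the sender's qutrits is, modulo scalars, a bijection onto $S$ modulo scalars, and whose joint $+1$ eigenspace $Q$ satisfies: $Q=\{(V\otimes I)(\psi\otimes\Phi):\psi\in(\mathbb C^3)^{\otimes k}\}$ for some isometry $V:(\mathbb C^3)^{\otimes k}\otimes(\mathbb C^3)^{\otimes c}\to(\mathbb C^3)^{\otimes n}$, where $\Phi=3^{-c/2}\sum_{y\in\mathbb F_3^c}|y\rangle|y\rangle$; and $Q$ detects all Pauli errors of weight less than $d$ on the sender's qutrits. A ternary entanglement-assisted quantum error-correcting code with noisy ebits (EAQECC-Ne) with parameters $[[n,k,d;c]]_3+[[m,k_b,d_b]]_3$ is a pair $(S,S^b)$ in which $S\le\mathcal E_n$ EA-stabilizes an $[[n,k,d;c]]_3$ code (used by the sender), $S^b\le\mathcal E_m$ stabilizes an $[[m,k_b,d_b]]_3$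 code (with which the receiver protects the $c$ ebits), and $k_b\ge c$. **Corollary 4.4.** There exist ternary EAQECCs-Ne with each of the parameters $[[11,1,7;2]]_3+[[6,2,3]]_3$, $[[26,2,11;2]]_3+[[6,2,3]]_3$, $[[28,2,11;4]]_3+[[8,4,3]]_3$, $[[14,2,9;6]]_3+[[10,6,3]]_3$ and $[[28,2,13;6]]_3+[[10,6,3]]_3$. -/

import Mathlib

open scoped Matrix

noncomputable section

namespace Qutrit

variable {ι : Type} [Fintype ι] [DecidableEq ι]

/-- State vectors of a register of qutrits indexed by `ι`: amplitudes over the computational basis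
`|x⟩`, `x : ι → 𝔽₃`. -/
abbrev State (ι : Type) : Type := (ι → ZMod 3) → ℂ

/-- Operators on a register of qutrits indexed by `ι`, as matrices in the computational basis. -/
abbrev Op (ι : Type) : Type := Matrix (ι → ZMod 3) (ι → ZMod 3) ℂ

/-- The phase `ω ^ t`, with `ω = exp (2 π i / 3)`. -/
def phase (t : ZMod 3) : ℂ := ZMod.stdAddChar t

/-- `X(a) |x⟩ = |x + a⟩`. -/
def pauliX (a : ι → ZMod 3) : Op ι := fun y x => if y = x + a then 1 else 0

/-- `Z(b) |x⟩ = ω ^ (b · x) |x⟩`. -/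
def pauliZ (b : ι → ZMod 3) : Op ι := Matrix.diagonal fun x => phase (b ⬝ᵥ x)

/-- The matrix `ω ^ t X(a) Z(b)`. -/
def pauliMat (t : ZMod 3) (a b : ι → ZMod 3) : Op ι := phase t • (pauliX a * pauliZ b)

theorem phase_add (s t : ZMod 3) : phase (s + t) = phase s * phase t :=
  AddChar.map_add_eq_mul _ _ _

theorem pauliMat_apply (t : ZMod 3) (a b y x : ι → ZMod 3) :
    pauliMat t a b y x = if y = x + a then phase (t + b ⬝ᵥ x) else 0 := by
  simp [pauliMat, pauliX, pauliZ, Matrix.mul_diagonal, phase_add]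

theorem pauliMat_mul (s t : ZMod 3) (a b a' b' : ι → ZMod 3) :
    pauliMat s a b * pauliMat t a' b' = pauliMat (s + t + b ⬝ᵥ a') (a + a') (b + b') := by
  ext y x
  rw [Matrix.mul_apply, Finset.sum_eq_single (x + a')]
  · simp only [pauliMat_apply, if_true, ite_mul, zero_mul, ← phase_add]
    rw [add_assoc x a' a, add_comm a' a]
    congr 2
    rw [dotProduct_add, add_dotProduct]
    ring
  · intro z _ hz
    simp [pauliMat_apply t a' b', hz]
  · intro h
    exact absurd (Finset.mem_univ _) h

theorem pauliMat_zero : pauliMat 0 0 0 = (1 : Op ι) := by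
  ext y x
  simp [pauliMat_apply, Matrix.one_apply, phase]

/-- The generalized Pauli operator `ω ^ t X(a) Z(b)`, as an invertible operator. -/
def pauli (t : ZMod 3) (a b : ι → ZMod 3) : (Op ι)ˣ where
  val := pauliMat t a b
  inv := pauliMat (-t + b ⬝ᵥ a) (-a) (-b)
  val_inv := by
    rw [pauliMat_mul, ← pauliMat_zero]
    congr 1 <;> simp
  inv_val := by
    rw [pauliMat_mul, ← pauliMat_zero]
    congr 1 <;> simp

theorem pauli_mul (s t : ZMod 3) (a b a' b' : ι → ZMod 3) :
    pauli s a b * pauli t a' b' = pauli (s + t + b ⬝ᵥ a') (a + a') (b + b') :=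
  Units.ext (pauliMat_mul s t a b a' b')

theorem pauli_zero : pauli 0 0 0 = (1 : (Op ι)ˣ) := Units.ext pauliMat_zero

theorem pauli_inv (t : ZMod 3) (a b : ι → ZMod 3) :
    (pauli t a b)⁻¹ = pauli (-t + b ⬝ᵥ a) (-a) (-b) := Units.ext rfl

/-- The generalized Pauli group `{ω ^ t X(a) Z(b)}` of the register. -/
def pauliGroup (ι : Type) [Fintype ι] [DecidableEq ι] : Subgroup (Op ι)ˣ where
  carrier := {g | ∃ t a b, g = pauli t a b}
  mul_mem' := by
    rintro _ _ ⟨s, a, b, rfl⟩ ⟨t, a', b', rfl⟩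
    exact ⟨_, _, _, pauli_mul s t a b a' b'⟩
  one_mem' := ⟨0, 0, 0, pauli_zero.symm⟩
  inv_mem' := by
    rintro _ ⟨t, a, b, rfl⟩
    exact ⟨_, _, _, pauli_inv t a b⟩

/-- The scalars `⟨ω I⟩` of the Pauli group. -/
def phaseGroup (ι : Type) [Fintype ι] [DecidableEq ι] : Subgroup (Op ι)ˣ where
  carrier := {g | ∃ t, g = pauli t 0 0}
  mul_mem' := by
    rintro _ _ ⟨s, rfl⟩ ⟨t, rfl⟩
    exact ⟨s + t, by rw [pauli_mul]; simp⟩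
  one_mem' := ⟨0, pauli_zero.symm⟩
  inv_mem' := by
    rintro _ ⟨t, rfl⟩
    exact ⟨-t, by rw [pauli_inv]; simp⟩

/-- The weight of `X(a) Z(b)`: the number of qutrits on which it is not a scalar. -/
def weight (a b : ι → ZMod 3) : ℕ := (Finset.univ.filter fun j => a j ≠ 0 ∨ b j ≠ 0).card

/-- The elements of the Pauli group that commute with all of `S`. -/
def commutant (S : Subgroup (Op ι)ˣ) : Subgroup (Op ι)ˣ :=
  pauliGroup ι ⊓ Subgroup.centralizer (S : Set (Op ι)ˣ)

/-- The isotropic part `S_I` of `S`. -/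
def isotropicPart (S : Subgroup (Op ι)ˣ) : Subgroup (Op ι)ˣ := S ⊓ commutant S

/-- The size of the image of `S` in the Pauli group modulo scalars. -/
def projCard (S : Subgroup (Op ι)ˣ) : ℕ := (phaseGroup ι).relIndex S

/-- The weights of the Pauli operators that commute with `S` but do not belong, up to a scalar, to
the isotropic part of `S`. -/
def logicalWeights (S : Subgroup (Op ι)ˣ) : Set ℕ :=
  {w | ∃ t a b, pauli t a b ∈ commutant S ∧ pauli t a b ∉ isotropicPart S ⊔ phaseGroup ι ∧
    weight a b = w}

/-- The joint `+1` eigenspace of the operators in `S`. -/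
def fixedSpace (S : Subgroup (Op ι)ˣ) : Submodule ℂ (State ι) where
  carrier := {ψ | ∀ g ∈ S, (g : Op ι) *ᵥ ψ = ψ}
  add_mem' := by
    intro φ ψ hφ hψ g hg
    rw [Matrix.mulVec_add, hφ g hg, hψ g hg]
  zero_mem' := by
    intro g _
    exact Matrix.mulVec_zero _
  smul_mem' := by
    intro z ψ hψ g hg
    rw [Matrix.mulVec_smul, hψ g hg]

/-- The code space `Q` detects the error `E`: `P E P = z P` for some scalar `z`, where `P` is the
orthogonal projection onto `Q`. -/
def Detects (Q : Submodule ℂ (State ι)) (E : Op ι) : Prop :=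
  ∃ z : ℂ, ∀ φ ∈ Q, ∀ ψ ∈ Q, star φ ⬝ᵥ (E *ᵥ ψ) = z * (star φ ⬝ᵥ ψ)

/-- An abelian subgroup of the Pauli group that contains no scalar besides the identity. -/
def IsStabilizer (S : Subgroup (Op ι)ˣ) : Prop :=
  S ≤ pauliGroup ι ∧ (∀ g ∈ S, ∀ h ∈ S, g * h = h * g) ∧ S ⊓ phaseGroup ι = ⊥

/-- `S` stabilizes an `[[m, k, d]]₃` quantum code: `S` is a stabilizer of size `3 ^ (m - k)`, `d` is
the least weight in `N(S) ∖ S`, and the space fixed by `S` has dimension `3 ^ k` and detects all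
errors of weight less than `d`. -/
structure Stabilizes {m : ℕ} (S : Subgroup (Op (Fin m))ˣ) (k d : ℕ) : Prop where
  isStabilizer : IsStabilizer S
  size : ∃ r : ℕ, k + r = m ∧ Nat.card S = 3 ^ r
  distance : IsLeast (logicalWeights S) d
  dimension : Module.finrank ℂ (fixedSpace S) = 3 ^ k
  detects : ∀ a b, weight a b < d → Detects (fixedSpace S) (pauliMat 0 a b)

/-- Encoding with the help of `c` maximally entangled pairs. The encoder `V` acts on the `k`
information qutrits and on the sender's halves of the pairs, and outputs `n` qutrits; the receiver's
halves are left alone. The encoded state of `ψ` is `(V ⊗ I) (ψ ⊗ Φ)`, where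
`Φ = 3 ^ (-c/2) ∑ y, |y⟩ |y⟩`. -/
def eaEncode {n k c : ℕ}
    (V : Matrix (Fin n → ZMod 3) ((Fin k → ZMod 3) × (Fin c → ZMod 3)) ℂ)
    (ψ : State (Fin k)) : State (Fin n ⊕ Fin c) :=
  fun x => ((Real.sqrt (3 ^ c) : ℝ) : ℂ)⁻¹ * ∑ s, V (x ∘ Sum.inl) (s, x ∘ Sum.inr) * ψ s

/-- `T`, a stabilizer on the `n` qutrits of the sender and the `c` qutrits of the receiver, extends
`S`: cutting the elements of `T` down to the sender's qutrits gives, up to scalars, each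
element of `S` exactly once. -/
structure Extends {n c : ℕ} (T : Subgroup (Op (Fin n ⊕ Fin c))ˣ) (S : Subgroup (Op (Fin n))ˣ) :
    Prop where
  isStabilizer : IsStabilizer T
  restrict : ∀ t a b, pauli t a b ∈ T → ∃ s, pauli s (a ∘ Sum.inl) (b ∘ Sum.inl) ∈ S
  lift : ∀ s a b, pauli s a b ∈ S → ∃ t a' b', pauli t (Sum.elim a a') (Sum.elim b b') ∈ T
  size : Nat.card T = projCard S

/-- `S` EA-stabilizes an `[[n, k, d; c]]₃` entanglement-assisted code. Up to scalars, the isotropic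
part of `S` has size `3 ^ l` and `S` has size `3 ^ (l + 2 c)`, where `k = n - c - l`; and `d` is the
least weight in `N(S) ∖ S_I`. The code space is the space fixed by an abelian extension of `S` to
the receiver's halves of `c` maximally entangled pairs; it is the set of encoded states of an
isometric encoder that acts on the sender's side only, and it detects all errors of weight less
than `d` on the sender's qutrits. -/
structure EAStabilizes {n : ℕ} (S : Subgroup (Op (Fin n))ˣ) (k d c : ℕ) : Prop where
  le_pauliGroup : S ≤ pauliGroup (Fin n)
  size : ∃ l : ℕ, k + c + l = n ∧ projCard (isotropicPart S) = 3 ^ l ∧ projCard S = 3 ^ (l + 2 * c)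
  distance : IsLeast (logicalWeights S) d
  code : ∃ T : Subgroup (Op (Fin n ⊕ Fin c))ˣ, Extends T S ∧
    (∃ V : Matrix (Fin n → ZMod 3) ((Fin k → ZMod 3) × (Fin c → ZMod 3)) ℂ,
      Vᴴ * V = 1 ∧ (fixedSpace T : Set (State (Fin n ⊕ Fin c))) = Set.range (eaEncode V)) ∧
    ∀ a b : Fin n → ZMod 3, weight a b < d →
      Detects (fixedSpace T) (pauliMat 0 (Sum.elim a 0) (Sum.elim b 0))

/-- There is a ternary entanglement-assisted quantum error-correcting code with noisy ebits, with
parameters `[[n, k, d; c]]₃ + [[m, k', d']]₃`: a pair of subgroups of the Pauli groups on `n` and `m`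
qutrits, of which the first EA-stabilizes an `[[n, k, d; c]]₃` code of the sender, and the second
stabilizes an `[[m, k', d']]₃` code with `k' ≥ c`, with which the receiver protects the `c` ebits. -/
def ExistsEAQECCNe (n k d c m k' d' : ℕ) : Prop :=
  ∃ (S : Subgroup (Op (Fin n))ˣ) (S' : Subgroup (Op (Fin m))ˣ),
    EAStabilizes S k d c ∧ Stabilizes S' k' d' ∧ c ≤ k'

end Qutrit

end

/-! Modulo scalars the Pauli group is the symplectic space `Vec ι` over 𝔽₃, and commutation is
vanishing of `symp`. On an isotropic subspace `W` the Weyl operators form a stabilizer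
(`weylGroup`); a Pauli error labelled in `W` acts as a scalar on its code space, and one outside the
symplectic complement maps the code space to an orthogonal space. So distance implies detection, and
a trace computation gives the dimension (`stabilizes_weylGroup`).

For entanglement assistance, `W` lives on the joint register of sender and receiver and projects
onto the receiver's whole phase space. Then every nontrivial Pauli operator on the receiver alone
has zero matrix elements on the code space, so the receiver's share is maximally mixed. This is what
produces an isometric encoder on the sender's side (`exists_isometry_eaEncode`,
`eaStabilizes_fullGroup`).

Such a `W` comes from a symplectic map `enc` of ancillas, ebit halves and information qutrits: the
ancillas contribute their Z operators, and each operator on an ebit half is paired with its complex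
conjugate on the other half. The distance is the least weight of `logical enc t u` with `u ≠ 0`
(`HasEncoder`).

Two constructions act on encoders. Gluing feeds `conj (u + x)` and `conj (u - x)` to two encoders
with the same `k`, where `x` belongs to `k` new ebits. This is symplectic because -2 = 1 in 𝔽₃; a
logical operator has `x = 0`, so it acts nontrivially on both blocks and distances add. Appending
lets the sender transmit extra bare ebit halves.

It remains to find ten small encoders. Each is a symplectic basis given by bit masks. Its distance
is certified in the manner of Brouwer and Zimmermann: a light word is light on the first or on the
last `κ` positions, each of which determines the word, so it suffices to enumerate combinations of
few rows (`EncoderData.hasEncoder`). -/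

set_option linter.unusedSectionVars false

/-! ### The Pauli group as a symplectic space, and Weyl stabilizers -/

noncomputable section
namespace Qutrit

variable {ι κ : Type} [Fintype ι] [DecidableEq ι] [Fintype κ] [DecidableEq κ]

/-- The phase space of a register of qutrits: pairs `(a, b)` labelling the operators `X(a) Z(b)`. -/
abbrev Vec (ι : Type) : Type := (ι → ZMod 3) × (ι → ZMod 3)

/-- The symplectic form on the phase space. -/
def symp (u v : Vec ι) : ZMod 3 := u.2 ⬝ᵥ v.1 - u.1 ⬝ᵥ v.2

theorem symp_add_left (u v w : Vec ι) : symp (u + v) w = symp u w + symp v w := by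
  simp only [symp, Prod.fst_add, Prod.snd_add, add_dotProduct]; ring

theorem symp_add_right (u v w : Vec ι) : symp u (v + w) = symp u v + symp u w := by
  simp only [symp, Prod.fst_add, Prod.snd_add, dotProduct_add]; ring

theorem symp_smul_left (r : ZMod 3) (u v : Vec ι) : symp (r • u) v = r * symp u v := by
  simp only [symp, Prod.smul_fst, Prod.smul_snd, smul_dotProduct, smul_eq_mul]; ring

theorem symp_smul_right (r : ZMod 3) (u v : Vec ι) : symp u (r • v) = r * symp u v := by
  simp only [symp, Prod.smul_fst, Prod.smul_snd, dotProduct_smul, smul_eq_mul]; ring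

theorem symp_neg_right (u v : Vec ι) : symp u (-v) = - symp u v := by
  simp [symp]; ring

theorem symp_swap (u v : Vec ι) : symp u v = - symp v u := by
  simp only [symp, dotProduct_comm]; ring

theorem symp_zero_left (v : Vec ι) : symp 0 v = 0 := by simp [symp]

theorem symp_zero_right (v : Vec ι) : symp v 0 = 0 := by simp [symp]

theorem symp_single_fst (v : Vec ι) (i : ι) : symp v (Pi.single i 1, 0) = v.2 i := by
  simp [symp]

theorem symp_single_snd (v : Vec ι) (i : ι) : symp v (0, Pi.single i 1) = - v.1 i := by
  simp [symp]

/-- The symplectic form is nondegenerate. -/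
theorem eq_zero_of_symp (v : Vec ι) (h : ∀ w, symp v w = 0) : v = 0 := by
  ext i
  · simpa [symp_single_snd] using h (0, Pi.single i 1)
  · simpa [symp_single_fst] using h (Pi.single i 1, 0)

/-- The symplectic complement of a set of vectors. -/
def sympCompl (C : Submodule (ZMod 3) (Vec ι)) : Submodule (ZMod 3) (Vec ι) where
  carrier := {v | ∀ w ∈ C, symp v w = 0}
  add_mem' := fun hu hv w hw => by rw [symp_add_left, hu w hw, hv w hw, add_zero]
  zero_mem' := fun w _ => symp_zero_left w
  smul_mem' := fun r v hv w hw => by rw [symp_smul_left, hv w hw, mul_zero]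

theorem phase_zero : phase 0 = 1 := AddChar.map_zero_eq_one _

theorem phase_injective : Function.Injective phase := ZMod.injective_stdAddChar

theorem phase_ne_zero (t : ZMod 3) : phase t ≠ 0 := by
  intro h
  have := phase_add t (-t)
  rw [add_neg_cancel, phase_zero, h, zero_mul] at this
  exact one_ne_zero this

theorem star_phase (t : ZMod 3) : star (phase t) = phase (-t) := by
  have := AddChar.map_neg_eq_conj (ZMod.stdAddChar (N := 3)) t
  exact this.symm

/-- Orthogonality of the characters of `𝔽₃ⁿ`. -/
theorem sum_phase (b : ι → ZMod 3) :
    ∑ x : ι → ZMod 3, phase (b ⬝ᵥ x) = if b = 0 then (3 : ℂ) ^ Fintype.card ι else 0 := by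
  split_ifs with h
  · simp [h, phase_zero, ZMod.card]
  · obtain ⟨i, hi⟩ := Function.ne_iff.mp h
    -- Translating the summation variable by the `i`-th unit vector multiplies the sum by `phase (b
    -- i)`, which is not 1.
    have key : ∑ x : ι → ZMod 3, phase (b ⬝ᵥ x) = phase (b i) * ∑ x, phase (b ⬝ᵥ x) := by
      rw [Finset.mul_sum, ← Equiv.sum_comp (Equiv.addRight (Pi.single i (1 : ZMod 3)))]
      refine Finset.sum_congr rfl fun x _ => ?_
      simp only [Equiv.coe_addRight, dotProduct_add, dotProduct_single, mul_one, phase_add]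
      ring
    have h1 : phase (b i) ≠ 1 := fun h' => hi (phase_injective (h'.trans phase_zero.symm))
    have : (1 - phase (b i)) * ∑ x : ι → ZMod 3, phase (b ⬝ᵥ x) = 0 := by
      rw [sub_mul, one_mul, ← key, sub_self]
    exact (mul_eq_zero.mp this).resolve_left (sub_ne_zero.mpr h1.symm)

theorem pauliMat_eq_phase_smul (t : ZMod 3) (a b : ι → ZMod 3) :
    pauliMat t a b = phase t • pauliMat 0 a b := by
  simp [pauliMat, phase_zero]

theorem pauliMat_injective {s t : ZMod 3} {a b a' b' : ι → ZMod 3}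
    (h : pauliMat s a b = pauliMat t a' b') : s = t ∧ a = a' ∧ b = b' := by
  -- Column `x` has a single nonzero entry; its row determines `a` and its value the exponent.
  -- Evaluating at 0 and at unit vectors then separates `s` from `b`.
  have h1 : ∀ x, x + a = x + a' ∧ s + b ⬝ᵥ x = t + b' ⬝ᵥ x := by
    intro x
    have := congrFun (congrFun h (x + a)) x
    rw [pauliMat_apply, pauliMat_apply, if_pos rfl] at this
    split_ifs at this with h2
    · exact ⟨h2, phase_injective this⟩
    · exact absurd this (phase_ne_zero _)
  have hs : s = t := by simpa using (h1 0).2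
  refine ⟨hs, by simpa using (h1 0).1, ?_⟩
  ext i
  simpa [hs] using (h1 (Pi.single i 1)).2

theorem pauli_inj {s t : ZMod 3} {a b a' b' : ι → ZMod 3} :
    pauli s a b = pauli t a' b' ↔ s = t ∧ a = a' ∧ b = b' := by
  refine ⟨fun h => pauliMat_injective (congrArg Units.val h), ?_⟩
  rintro ⟨rfl, rfl, rfl⟩; rfl

theorem pauliMat_comm (s t : ZMod 3) (u v : Vec ι) :
    pauliMat s u.1 u.2 * pauliMat t v.1 v.2 =
      phase (symp u v) • (pauliMat t v.1 v.2 * pauliMat s u.1 u.2) := by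
  rw [pauliMat_mul, pauliMat_mul, pauliMat_eq_phase_smul, pauliMat_eq_phase_smul (t + s + _),
    smul_smul, ← phase_add, add_comm v.1, add_comm v.2, symp]
  congr 2
  rw [dotProduct_comm u.1]; ring

/-- The phases `s` and `t` cancel, so commutants can be computed as symplectic complements of sets
of labels. -/
theorem pauli_commute_iff (s t : ZMod 3) (u v : Vec ι) :
    pauli s u.1 u.2 * pauli t v.1 v.2 = pauli t v.1 v.2 * pauli s u.1 u.2 ↔ symp u v = 0 := by
  rw [pauli_mul, pauli_mul, pauli_inj, symp, sub_eq_zero, dotProduct_comm u.1]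
  constructor
  · rintro ⟨h, -, -⟩
    rw [add_comm t s] at h
    exact add_left_cancel h
  · intro h
    exact ⟨by rw [h, add_comm s t], add_comm _ _, add_comm _ _⟩

/-- All Pauli operators `ω ^ t X(a) Z(b)` with `(a, b) ∈ C`. -/
def fullGroup (C : Submodule (ZMod 3) (Vec ι)) : Subgroup (Op ι)ˣ where
  carrier := {g | ∃ t a b, (a, b) ∈ C ∧ g = pauli t a b}
  mul_mem' := by
    rintro _ _ ⟨s, a, b, h, rfl⟩ ⟨t, a', b', h', rfl⟩
    exact ⟨_, _, _, C.add_mem h h', pauli_mul s t a b a' b'⟩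
  one_mem' := ⟨0, 0, 0, C.zero_mem, pauli_zero.symm⟩
  inv_mem' := by
    rintro _ ⟨t, a, b, h, rfl⟩
    exact ⟨_, _, _, C.neg_mem h, pauli_inv t a b⟩

theorem pauli_mem_fullGroup {C : Submodule (ZMod 3) (Vec ι)} {t : ZMod 3} {a b : ι → ZMod 3} :
    pauli t a b ∈ fullGroup C ↔ (a, b) ∈ C := by
  constructor
  · rintro ⟨s, a', b', h, h'⟩
    obtain ⟨-, rfl, rfl⟩ := pauli_inj.mp h'
    exact h
  · exact fun h => ⟨t, a, b, h, rfl⟩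

theorem fullGroup_le_pauliGroup (C : Submodule (ZMod 3) (Vec ι)) :
    fullGroup C ≤ pauliGroup ι := by
  rintro _ ⟨t, a, b, -, rfl⟩
  exact ⟨t, a, b, rfl⟩

theorem phaseGroup_le_fullGroup (C : Submodule (ZMod 3) (Vec ι)) :
    phaseGroup ι ≤ fullGroup C := by
  rintro _ ⟨t, rfl⟩
  exact pauli_mem_fullGroup.mpr C.zero_mem

theorem commutant_fullGroup (C : Submodule (ZMod 3) (Vec ι)) :
    commutant (fullGroup C) = fullGroup (sympCompl C) := by
  ext g
  constructor
  · rintro ⟨⟨t, a, b, rfl⟩, h⟩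
    refine pauli_mem_fullGroup.mpr fun w hw => ?_
    have := Subgroup.mem_centralizer_iff.mp h (pauli 0 w.1 w.2) (pauli_mem_fullGroup.mpr hw)
    exact (pauli_commute_iff t 0 (a, b) w).mp this.symm
  · rintro ⟨t, a, b, h, rfl⟩
    refine ⟨⟨t, a, b, rfl⟩, Subgroup.mem_centralizer_iff.mpr ?_⟩
    rintro _ ⟨s, a', b', h', rfl⟩
    exact ((pauli_commute_iff t s (a, b) (a', b')).mpr (h _ h')).symm

theorem isotropicPart_fullGroup (C : Submodule (ZMod 3) (Vec ι)) :
    isotropicPart (fullGroup C) = fullGroup (C ⊓ sympCompl C) := by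
  ext g
  rw [isotropicPart, commutant_fullGroup]
  constructor
  · rintro ⟨⟨t, a, b, h, rfl⟩, h'⟩
    exact pauli_mem_fullGroup.mpr ⟨h, pauli_mem_fullGroup.mp h'⟩
  · rintro ⟨t, a, b, h, rfl⟩
    exact ⟨pauli_mem_fullGroup.mpr h.1, pauli_mem_fullGroup.mpr h.2⟩

theorem card_phaseGroup : Nat.card (phaseGroup ι) = 3 := by
  have : Function.Bijective
      (fun t : ZMod 3 => (⟨pauli t 0 0, t, rfl⟩ : phaseGroup ι)) := by
    refine ⟨fun s t h => (pauli_inj.mp (congrArg Subtype.val h)).1, ?_⟩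
    rintro ⟨_, t, rfl⟩
    exact ⟨t, rfl⟩
  rw [← Nat.card_congr (Equiv.ofBijective _ this), Nat.card_zmod]

theorem card_fullGroup (C : Submodule (ZMod 3) (Vec ι)) :
    Nat.card (fullGroup C) = 3 * Nat.card C := by
  have : Function.Bijective (fun p : ZMod 3 × C =>
      (⟨pauli p.1 p.2.1.1 p.2.1.2, pauli_mem_fullGroup.mpr p.2.2⟩ : fullGroup C)) := by
    constructor
    · rintro ⟨s, ⟨u, hu⟩⟩ ⟨t, ⟨v, hv⟩⟩ h
      obtain ⟨rfl, h1, h2⟩ := pauli_inj.mp (congrArg Subtype.val h)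
      have : u = v := Prod.ext h1 h2
      subst this; rfl
    · rintro ⟨_, t, a, b, h, rfl⟩
      exact ⟨(t, ⟨(a, b), h⟩), rfl⟩
  rw [← Nat.card_congr (Equiv.ofBijective _ this), Nat.card_prod, Nat.card_zmod]

theorem projCard_fullGroup (C : Submodule (ZMod 3) (Vec ι)) :
    projCard (fullGroup C) = Nat.card C := by
  have h := Subgroup.relIndex_mul_relIndex ⊥ (phaseGroup ι) (fullGroup C) bot_le
    (phaseGroup_le_fullGroup C)
  rw [Subgroup.relIndex_bot_left, Subgroup.relIndex_bot_left, card_phaseGroup,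
    card_fullGroup] at h
  exact Nat.eq_of_mul_eq_mul_left (by norm_num) h

/-- The weight of a vector of the phase space. -/
def wt (v : Vec ι) : ℕ := weight v.1 v.2

/-- For a vector already in the complement, lying outside the isotropic part is the same as lying
outside `C`; the scalars are contained in every `fullGroup`. -/
theorem logicalWeights_fullGroup (C : Submodule (ZMod 3) (Vec ι)) :
    logicalWeights (fullGroup C) = {w | ∃ v ∈ sympCompl C, v ∉ C ∧ wt v = w} := by
  ext w
  rw [logicalWeights, isotropicPart_fullGroup, commutant_fullGroup,
    sup_eq_left.mpr (phaseGroup_le_fullGroup _)]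
  constructor
  · rintro ⟨t, a, b, h, h', rfl⟩
    rw [pauli_mem_fullGroup] at h h'
    exact ⟨(a, b), h, fun hC => h' ⟨hC, h⟩, rfl⟩
  · rintro ⟨v, h, h', rfl⟩
    exact ⟨0, v.1, v.2, pauli_mem_fullGroup.mpr h, fun hv => h' (pauli_mem_fullGroup.mp hv).1, rfl⟩

/-- A subspace on which the symplectic form vanishes. -/
def IsIsotropic (W : Submodule (ZMod 3) (Vec ι)) : Prop := ∀ u ∈ W, ∀ v ∈ W, symp u v = 0

/-- The phase `t` for which `v ↦ ω ^ t X(a) Z(b)`, `v = (a, b)`, is multiplicative on isotropic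
subspaces. -/
def weylPhase (v : Vec ι) : ZMod 3 := 2 * (v.1 ⬝ᵥ v.2)

/-- The Weyl operator of a vector of the phase space. -/
def weyl (v : Vec ι) : (Op ι)ˣ := pauli (weylPhase v) v.1 v.2

/-- In 𝔽₃ the factor 2 in `weylPhase` is one half. The polarization of ½ a·b is the symmetrized
cocycle, which equals the cocycle u₂·v₁ of the Pauli product when u and v are orthogonal. -/
theorem weyl_mul {u v : Vec ι} (h : symp u v = 0) : weyl u * weyl v = weyl (u + v) := by
  rw [weyl, weyl, weyl, pauli_mul]
  refine pauli_inj.mpr ⟨?_, rfl, rfl⟩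
  rw [symp, sub_eq_zero] at h
  simp only [weylPhase, Prod.fst_add, Prod.snd_add, dotProduct_add, add_dotProduct, ← h]
  rw [dotProduct_comm v.1 u.2]
  ring_nf
  reduce_mod_char

theorem weyl_zero : weyl (0 : Vec ι) = 1 := by simp [weyl, weylPhase, pauli_zero]

theorem weyl_injective : Function.Injective (weyl : Vec ι → (Op ι)ˣ) := by
  intro u v h
  obtain ⟨-, h1, h2⟩ := pauli_inj.mp h
  exact Prod.ext h1 h2

theorem inv_weyl (v : Vec ι) : (weyl v)⁻¹ = weyl (-v) := by
  rw [inv_eq_iff_mul_eq_one, weyl_mul, add_neg_cancel, weyl_zero]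
  simp [symp, dotProduct_comm]

/-- The stabilizer that consists of the Weyl operators of an isotropic subspace. -/
def weylGroup (W : Submodule (ZMod 3) (Vec ι)) (hW : IsIsotropic W) : Subgroup (Op ι)ˣ where
  carrier := {g | ∃ v ∈ W, g = weyl v}
  mul_mem' := by
    rintro _ _ ⟨u, hu, rfl⟩ ⟨v, hv, rfl⟩
    exact ⟨_, W.add_mem hu hv, weyl_mul (hW u hu v hv)⟩
  one_mem' := ⟨0, W.zero_mem, weyl_zero.symm⟩
  inv_mem' := by
    rintro _ ⟨u, hu, rfl⟩
    exact ⟨_, W.neg_mem hu, inv_weyl u⟩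

variable {W : Submodule (ZMod 3) (Vec ι)} {hW : IsIsotropic W}

theorem weyl_mem_weylGroup {v : Vec ι} : weyl v ∈ weylGroup W hW ↔ v ∈ W :=
  ⟨fun ⟨_, hu, h⟩ => weyl_injective h ▸ hu, fun h => ⟨v, h, rfl⟩⟩

theorem mem_of_pauli_mem_weylGroup {t : ZMod 3} {a b : ι → ZMod 3}
    (h : pauli t a b ∈ weylGroup W hW) : (a, b) ∈ W := by
  obtain ⟨u, hu, h⟩ := h
  obtain ⟨-, rfl, rfl⟩ := pauli_inj.mp h
  exact hu

theorem isStabilizer_weylGroup : IsStabilizer (weylGroup W hW) := by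
  refine ⟨?_, ?_, ?_⟩
  · rintro _ ⟨v, -, rfl⟩
    exact ⟨_, _, _, rfl⟩
  · rintro _ ⟨u, hu, rfl⟩ _ ⟨v, hv, rfl⟩
    rw [weyl_mul (hW u hu v hv), weyl_mul (hW v hv u hu), add_comm]
  · rw [eq_bot_iff]
    rintro _ ⟨⟨v, -, rfl⟩, t, h⟩
    obtain ⟨-, h1, h2⟩ := pauli_inj.mp h
    have : v = 0 := Prod.ext h1 h2
    rw [this, weyl_zero]
    exact Subgroup.mem_bot.mpr rfl

theorem card_weylGroup : Nat.card (weylGroup W hW) = Nat.card W := by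
  have : Function.Bijective
      (fun v : W => (⟨weyl v.1, weyl_mem_weylGroup.mpr v.2⟩ : weylGroup W hW)) := by
    constructor
    · exact fun u v h => Subtype.ext (weyl_injective (congrArg Subtype.val h))
    · rintro ⟨_, v, hv, rfl⟩
      exact ⟨⟨v, hv⟩, rfl⟩
  exact (Nat.card_congr (Equiv.ofBijective _ this)).symm

theorem commutant_weylGroup : commutant (weylGroup W hW) = fullGroup (sympCompl W) := by
  ext g
  constructor
  · rintro ⟨⟨t, a, b, rfl⟩, h⟩
    refine pauli_mem_fullGroup.mpr fun w hw => ?_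
    have := Subgroup.mem_centralizer_iff.mp h (weyl w) (weyl_mem_weylGroup.mpr hw)
    exact (pauli_commute_iff t _ (a, b) w).mp this.symm
  · rintro ⟨t, a, b, h, rfl⟩
    refine ⟨⟨t, a, b, rfl⟩, Subgroup.mem_centralizer_iff.mpr ?_⟩
    rintro _ ⟨v, hv, rfl⟩
    exact ((pauli_commute_iff t _ (a, b) v).mpr (h _ hv)).symm

/-- An isotropic `W` lies in its own complement, so the isotropic part is the entire group;
adjoining the scalars restores all phases. -/
theorem isotropicPart_weylGroup_sup :
    isotropicPart (weylGroup W hW) ⊔ phaseGroup ι = fullGroup W := by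
  have h1 : isotropicPart (weylGroup W hW) = weylGroup W hW := by
    refine inf_eq_left.mpr ?_
    rw [commutant_weylGroup]
    rintro _ ⟨v, hv, rfl⟩
    exact pauli_mem_fullGroup.mpr fun w hw => hW v hv w hw
  rw [h1]
  apply le_antisymm
  · refine sup_le ?_ (phaseGroup_le_fullGroup W)
    rintro _ ⟨v, hv, rfl⟩
    exact pauli_mem_fullGroup.mpr hv
  · rintro _ ⟨t, a, b, h, rfl⟩
    have : pauli t a b = weyl (a, b) * pauli (t - weylPhase (a, b)) 0 0 := by
      rw [weyl, pauli_mul]; simp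
    rw [this]
    exact Subgroup.mul_mem_sup (weyl_mem_weylGroup.mpr h) ⟨_, rfl⟩

theorem logicalWeights_weylGroup :
    logicalWeights (weylGroup W hW) = {w | ∃ v ∈ sympCompl W, v ∉ W ∧ wt v = w} := by
  ext w
  rw [logicalWeights, isotropicPart_weylGroup_sup, commutant_weylGroup]
  constructor
  · rintro ⟨t, a, b, h, h', rfl⟩
    rw [pauli_mem_fullGroup] at h h'
    exact ⟨(a, b), h, h', rfl⟩
  · rintro ⟨v, h, h', rfl⟩
    exact ⟨0, v.1, v.2, pauli_mem_fullGroup.mpr h, fun hv => h' (pauli_mem_fullGroup.mp hv), rfl⟩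

end Qutrit
end

/-! ### Code spaces of stabilizers: detection of errors and dimension -/

noncomputable section
namespace Qutrit

variable {ι κ : Type} [Fintype ι] [DecidableEq ι] [Fintype κ] [DecidableEq κ]
variable {W : Submodule (ZMod 3) (Vec ι)} {hW : IsIsotropic W}

theorem conjTranspose_pauliMat (t : ZMod 3) (a b : ι → ZMod 3) :
    (pauliMat t a b)ᴴ = pauliMat (-t + b ⬝ᵥ a) (-a) (-b) := by
  ext y x
  rw [Matrix.conjTranspose_apply, pauliMat_apply, pauliMat_apply]
  by_cases h : x = y + a
  · have h' : y = x + -a := by rw [h]; abel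
    rw [if_pos h, if_pos h', star_phase, h]
    congr 1
    rw [neg_dotProduct, dotProduct_add]; ring
  · have h' : ¬ y = x + -a := fun h' => h (by rw [h']; abel)
    rw [if_neg h, if_neg h', star_zero]

theorem star_dotProduct_pauli_mulVec (g : (Op ι)ˣ) (hg : g ∈ pauliGroup ι) (φ χ : State ι) :
    star φ ⬝ᵥ ((g : Op ι) *ᵥ χ) = star (((g⁻¹ : (Op ι)ˣ) : Op ι) *ᵥ φ) ⬝ᵥ χ := by
  obtain ⟨t, a, b, rfl⟩ := hg
  have : ((pauli t a b)⁻¹ : (Op ι)ˣ).val = ((pauli t a b : (Op ι)ˣ) : Op ι)ᴴ := by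
    rw [pauli_inv]; exact (conjTranspose_pauliMat t a b).symm
  rw [this, Matrix.star_mulVec, Matrix.conjTranspose_conjTranspose, Matrix.dotProduct_mulVec]

theorem star_dotProduct_fixed {S : Subgroup (Op ι)ˣ} (hS : S ≤ pauliGroup ι) {g : (Op ι)ˣ}
    (hg : g ∈ S) {φ : State ι} (hφ : φ ∈ fixedSpace S) (χ : State ι) :
    star φ ⬝ᵥ ((g : Op ι) *ᵥ χ) = star φ ⬝ᵥ χ := by
  rw [star_dotProduct_pauli_mulVec g (hS hg), hφ _ (S.inv_mem hg)]

/-- A Pauli error that does not commute with the stabilizer maps the code space to an orthogonal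
space. -/
theorem star_dotProduct_pauliMat_eq_zero {v w : Vec ι} (hw : w ∈ W) (h : symp v w ≠ 0)
    (t : ZMod 3) {φ ψ : State ι} (hφ : φ ∈ fixedSpace (weylGroup W hW))
    (hψ : ψ ∈ fixedSpace (weylGroup W hW)) :
    star φ ⬝ᵥ (pauliMat t v.1 v.2 *ᵥ ψ) = 0 := by
  have hg : weyl w ∈ weylGroup W hW := weyl_mem_weylGroup.mpr hw
  -- Insert `weyl w` in front of `ψ`, which it fixes, move it past the error at the cost of a phase
  -- other than 1, and absorb it into `φ`.
  have key : star φ ⬝ᵥ (pauliMat t v.1 v.2 *ᵥ ψ) =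
      phase (symp v w) * star φ ⬝ᵥ (pauliMat t v.1 v.2 *ᵥ ψ) := by
    conv_lhs => rw [← hψ _ hg, Matrix.mulVec_mulVec]
    change star φ ⬝ᵥ ((pauliMat t v.1 v.2 * pauliMat (weylPhase w) w.1 w.2) *ᵥ ψ) = _
    rw [pauliMat_comm, Matrix.smul_mulVec, dotProduct_smul, ← Matrix.mulVec_mulVec, smul_eq_mul]
    congr 1
    exact star_dotProduct_fixed isStabilizer_weylGroup.1 hg hφ _
  have h1 : phase (symp v w) ≠ 1 := fun h' => h (phase_injective (h'.trans phase_zero.symm))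
  have : (1 - phase (symp v w)) * star φ ⬝ᵥ (pauliMat t v.1 v.2 *ᵥ ψ) = 0 := by
    rw [sub_mul, one_mul, ← key, sub_self]
  exact (mul_eq_zero.mp this).resolve_left (sub_ne_zero.mpr h1.symm)

/-- An error in `W` is a scalar times a stabilizer element; any other admissible error fails to
commute with some element and gives `z = 0`. -/
theorem detects_weylGroup {v : Vec ι} (h : v ∈ sympCompl W → v ∈ W) (t : ZMod 3) :
    Detects (fixedSpace (weylGroup W hW)) (pauliMat t v.1 v.2) := by
  by_cases hv : v ∈ W
  · refine ⟨phase (t - weylPhase v), fun φ _ ψ hψ => ?_⟩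
    have h1 : pauliMat t v.1 v.2 =
        phase (t - weylPhase v) • ((weyl v : (Op ι)ˣ) : Op ι) := by
      change _ = phase _ • pauliMat _ v.1 v.2
      rw [pauliMat_eq_phase_smul t, pauliMat_eq_phase_smul (weylPhase v), smul_smul, ← phase_add,
        sub_add_cancel]
    rw [h1, Matrix.smul_mulVec, hψ _ (weyl_mem_weylGroup.mpr hv), dotProduct_smul, smul_eq_mul]
  · have : ¬ ∀ w ∈ W, symp v w = 0 := fun h' => hv (h h')
    push Not at this
    obtain ⟨w, hw, h'⟩ := this
    exact ⟨0, fun φ hφ ψ hψ => by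
      rw [star_dotProduct_pauliMat_eq_zero hw h' t hφ hψ, zero_mul]⟩

theorem trace_pauliMat (t : ZMod 3) (v : Vec ι) :
    (pauliMat t v.1 v.2).trace = if v = 0 then phase t * 3 ^ Fintype.card ι else 0 := by
  simp only [Matrix.trace, Matrix.diag_apply, pauliMat_apply, left_eq_add]
  by_cases ha : v.1 = 0
  · simp only [ha, if_true, phase_add, ← Finset.mul_sum, sum_phase, Prod.ext_iff, Prod.fst_zero,
      Prod.snd_zero, true_and, mul_ite, mul_zero]
  · simp [ha, Prod.ext_iff]

/-- The average of the Weyl operators over `W` is a projection onto the fixed space, so its trace is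
the dimension. Only the identity has nonzero trace. -/
theorem finrank_fixedSpace_mul_card :
    Module.finrank ℂ (fixedSpace (weylGroup W hW)) * Nat.card W = 3 ^ Fintype.card ι := by
  classical
  have hc : (Fintype.card W : ℂ) ≠ 0 := by
    exact_mod_cast Fintype.card_ne_zero
  set P : Op ι := (Fintype.card W : ℂ)⁻¹ • ∑ w : W, ((weyl w.1 : (Op ι)ˣ) : Op ι) with hP
  have hproj : LinearMap.IsProj (fixedSpace (weylGroup W hW)) (Matrix.toLin' P) := by
    constructor
    · rintro χ _ ⟨v, hv, rfl⟩
      rw [Matrix.toLin'_apply, Matrix.mulVec_mulVec, hP, mul_smul_comm, Finset.mul_sum]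
      congr 2
      -- Multiplication by `weyl v` merely permutes the summands.
      rw [← Equiv.sum_comp (Equiv.addLeft (⟨v, hv⟩ : W)) fun w : W => ((weyl w.1 : (Op ι)ˣ) : Op ι)]
      refine Finset.sum_congr rfl fun w _ => ?_
      rw [← Units.val_mul, weyl_mul (hW v hv w w.2)]
      rfl
    · intro χ hχ
      rw [Matrix.toLin'_apply, hP, Matrix.smul_mulVec, Matrix.sum_mulVec,
        Finset.sum_congr rfl fun w _ => hχ _ (weyl_mem_weylGroup.mpr w.2)]
      rw [Finset.sum_const, Finset.card_univ, ← Nat.cast_smul_eq_nsmul ℂ, smul_smul,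
        inv_mul_cancel₀ hc, one_smul]
  have h1 := hproj.trace
  rw [Matrix.trace_toLin'_eq, hP, Matrix.trace_smul, Matrix.trace_sum,
    Finset.sum_eq_single (0 : W)] at h1
  · have h2 : ((weyl ((0 : W) : Vec ι) : (Op ι)ˣ) : Op ι).trace = 3 ^ Fintype.card ι := by
      change (pauliMat (weylPhase _) _ _).trace = _
      rw [trace_pauliMat]; simp [weylPhase, phase_zero]
    rw [h2, smul_eq_mul, inv_mul_eq_iff_eq_mul₀ hc] at h1
    rw [Nat.card_eq_fintype_card, mul_comm]
    exact_mod_cast h1.symm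
  · intro w _ hw
    change (pauliMat (weylPhase _) _ _).trace = _
    have h0 : (w : Vec ι) ≠ 0 := fun h => hw (Subtype.ext h)
    rw [trace_pauliMat, if_neg h0]
  · exact fun h => absurd (Finset.mem_univ _) h

/-- The stabilizer code of an isotropic subspace. -/
theorem stabilizes_weylGroup {m k r d : ℕ} {W : Submodule (ZMod 3) (Vec (Fin m))}
    (hW : IsIsotropic W) (hm : k + r = m) (hcard : Nat.card W = 3 ^ r)
    (hd : IsLeast {w | ∃ v ∈ sympCompl W, v ∉ W ∧ wt v = w} d) :
    Stabilizes (weylGroup W hW) k d where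
  isStabilizer := isStabilizer_weylGroup
  size := ⟨r, hm, card_weylGroup.trans hcard⟩
  distance := by rwa [logicalWeights_weylGroup]
  dimension := by
    have h := finrank_fixedSpace_mul_card (W := W) (hW := hW)
    have h' : (3 : ℕ) ^ m = 3 ^ k * 3 ^ r := by rw [← hm, pow_add]
    rw [hcard, Fintype.card_fin, h'] at h
    exact Nat.eq_of_mul_eq_mul_right (by positivity) h
  detects := by
    intro a b hab
    refine detects_weylGroup (v := (a, b)) (fun h => ?_) 0
    by_contra h'
    exact absurd (hd.2 ⟨(a, b), h, h', rfl⟩) (not_le.mpr hab)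

end Qutrit
end

/-! ### Entanglement-assisted codes from isotropic subspaces of the joint register -/

noncomputable section
namespace Qutrit

variable {ι κ : Type} [Fintype ι] [DecidableEq ι] [Fintype κ] [DecidableEq κ]

/-- Juxtaposition of vectors of two phase spaces. -/
def join (v : Vec ι) (r : Vec κ) : Vec (ι ⊕ κ) := (Sum.elim v.1 r.1, Sum.elim v.2 r.2)

theorem join_add (v v' : Vec ι) (r r' : Vec κ) :
    join (v + v') (r + r') = join v r + join v' r' := by
  ext i <;> cases i <;> rfl

theorem join_smul (t : ZMod 3) (v : Vec ι) (r : Vec κ) :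
    join (t • v) (t • r) = t • join v r := by
  ext i <;> cases i <;> rfl

theorem symp_join (v v' : Vec ι) (r r' : Vec κ) :
    symp (join v r) (join v' r') = symp v v' + symp r r' := by
  simp [symp, join]; ring

theorem join_inj {v v' : Vec ι} {r r' : Vec κ} : join v r = join v' r' ↔ v = v' ∧ r = r' := by
  constructor
  · intro h
    have h1 := congrArg Prod.fst h
    have h2 := congrArg Prod.snd h
    exact ⟨Prod.ext (funext fun i => congrFun h1 (.inl i)) (funext fun i => congrFun h2 (.inl i)),
      Prod.ext (funext fun i => congrFun h1 (.inr i)) (funext fun i => congrFun h2 (.inr i))⟩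
  · rintro ⟨rfl, rfl⟩; rfl

theorem exists_join (x : Vec (ι ⊕ κ)) : ∃ v r, x = join (ι := ι) (κ := κ) v r :=
  ⟨(x.1 ∘ Sum.inl, x.2 ∘ Sum.inl), (x.1 ∘ Sum.inr, x.2 ∘ Sum.inr), by
    ext i <;> cases i <;> rfl⟩

theorem wt_eq_sum (v : Vec ι) : wt v = ∑ i, if v.1 i ≠ 0 ∨ v.2 i ≠ 0 then 1 else 0 := by
  rw [wt, weight, Finset.card_filter]

theorem wt_join (v : Vec ι) (r : Vec κ) : wt (join v r) = wt v + wt r := by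
  rw [wt_eq_sum, wt_eq_sum, wt_eq_sum, Fintype.sum_sum_type]
  rfl

/-- Cutting the vectors of a subspace down to the first register. -/
def senderPart (W : Submodule (ZMod 3) (Vec (ι ⊕ κ))) : Submodule (ZMod 3) (Vec ι) where
  carrier := {v | ∃ r, join v r ∈ W}
  add_mem' := fun ⟨r, h⟩ ⟨r', h'⟩ => ⟨r + r', by rw [join_add]; exact W.add_mem h h'⟩
  zero_mem' := ⟨0, by
    have : join (0 : Vec ι) (0 : Vec κ) = 0 := by ext i <;> cases i <;> rfl
    rw [this]; exact W.zero_mem⟩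
  smul_mem' := fun t _ ⟨r, h⟩ => ⟨t • r, by rw [join_smul]; exact W.smul_mem t h⟩

variable {W : Submodule (ZMod 3) (Vec (ι ⊕ κ))}

/-- The receiver's component 0 contributes nothing to the form, so an error of the sender sees only
the sender's part of `W`. -/
theorem mem_sympCompl_senderPart {v : Vec ι} :
    v ∈ sympCompl (senderPart W) ↔ join v (0 : Vec κ) ∈ sympCompl W := by
  constructor
  · intro h x hx
    obtain ⟨w, r, rfl⟩ := exists_join x
    rw [symp_join, symp_zero_left, add_zero]
    exact h w ⟨r, hx⟩
  · rintro h w ⟨r, hr⟩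
    simpa [symp_join, symp_zero_left] using h _ hr

section Surjective

variable (hW : IsIsotropic W) (hsurj : ∀ r : Vec κ, ∃ v : Vec ι, join v r ∈ W)

include hW hsurj

/-- By isotropy `r` is orthogonal to the receiver's part of every element of `W`, hence to
everything. This makes restriction to the sender injective on `W`. -/
theorem eq_zero_of_join_zero_mem {r : Vec κ} (h : join (0 : Vec ι) r ∈ W) : r = 0 := by
  refine eq_zero_of_symp r fun r' => ?_
  obtain ⟨v, hv⟩ := hsurj r'
  simpa [symp_join, symp_zero_left] using hW _ h _ hv

theorem join_mem_unique {v : Vec ι} {r r' : Vec κ} (h : join v r ∈ W) (h' : join v r' ∈ W) :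
    r = r' := by
  have h1 : join (0 : Vec ι) (r - r') ∈ W := by
    have := W.sub_mem h h'
    have h2 : join v r - join v r' = join (0 : Vec ι) (r - r') := by
      ext i <;> cases i <;> simp [join]
    rwa [h2] at this
  exact sub_eq_zero.mp (eq_zero_of_join_zero_mem hW hsurj h1)

/-- If `v` is orthogonal to all sender's parts, isotropy forces its companion `r` to be orthogonal
to all receiver's parts, so `r = 0`. Thus the isotropic part of `S` consists of the labels that need
no action of the receiver. -/
theorem mem_senderPart_inf_iff {v : Vec ι} :
    v ∈ senderPart W ⊓ sympCompl (senderPart W) ↔ join v (0 : Vec κ) ∈ W := by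
  constructor
  · rintro ⟨⟨r, hr⟩, h⟩
    have : r = 0 := by
      refine eq_zero_of_symp r fun r' => ?_
      obtain ⟨w, hw⟩ := hsurj r'
      have h1 := hW _ hr _ hw
      rwa [symp_join, h w ⟨r', hw⟩, zero_add] at h1
    rwa [this] at hr
  · intro h
    exact ⟨⟨0, h⟩, mem_sympCompl_senderPart.mpr fun x hx => hW _ h x hx⟩

theorem card_senderPart : Nat.card (senderPart W) = Nat.card W := by
  symm
  have : ∀ x : W, ∃ v : senderPart W, ∃ r, x.1 = join v.1 r := fun ⟨x, hx⟩ => by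
    obtain ⟨v, r, rfl⟩ := exists_join x
    exact ⟨⟨v, r, hx⟩, r, rfl⟩
  choose f g hfg using this
  refine Nat.card_congr (Equiv.ofBijective f ⟨fun x y h => ?_, fun ⟨v, r, hr⟩ => ⟨⟨_, hr⟩, ?_⟩⟩)
  · have hx := x.2
    have hy := y.2
    rw [hfg] at hx hy
    rw [← h] at hy
    exact Subtype.ext (by rw [hfg x, hfg y, ← h, join_mem_unique hW hsurj hx hy])
  · exact Subtype.ext (join_inj.mp (hfg ⟨_, hr⟩)).1.symm

/-- Projection of `W` to the receiver is onto with this intersection as kernel; chosen lifts `f r`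
split `W` into cosets. -/
theorem card_senderPart_inf :
    Nat.card (senderPart W ⊓ sympCompl (senderPart W) : Submodule (ZMod 3) (Vec ι)) *
      Nat.card (Vec κ) = Nat.card W := by
  choose f hf using hsurj
  rw [← Nat.card_prod]
  refine Nat.card_congr (Equiv.ofBijective (fun p => ⟨join (p.1.1 + f p.2) p.2, ?_⟩) ⟨?_, ?_⟩)
  · have h := W.add_mem ((mem_senderPart_inf_iff hW fun r => ⟨f r, hf r⟩).mp p.1.2) (hf p.2)
    rwa [← join_add, zero_add] at h
  · rintro ⟨⟨u, hu⟩, r⟩ ⟨⟨v, hv⟩, r'⟩ h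
    obtain ⟨h1, h2⟩ := join_inj.mp (congrArg Subtype.val h)
    simp only at h2
    subst h2
    simp only [add_left_inj] at h1
    subst h1; rfl
  · rintro ⟨x, hx⟩
    obtain ⟨v, r, rfl⟩ := exists_join x
    refine ⟨⟨⟨v - f r, (mem_senderPart_inf_iff hW fun r => ⟨f r, hf r⟩).mpr ?_⟩, r⟩,
      Subtype.ext (by simp)⟩
    have := W.sub_mem hx (hf r)
    have h2 : join v r - join (f r) r = join (v - f r) (0 : Vec κ) := by
      ext i <;> cases i <;> simp [join]
    rwa [h2] at this

/-- The receiver's part of the code states is maximally mixed. -/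
theorem sum_star_mul_fixed {φ ψ : State (ι ⊕ κ)} (hφ : φ ∈ fixedSpace (weylGroup W hW))
    (hψ : ψ ∈ fixedSpace (weylGroup W hW)) (y y' : κ → ZMod 3) :
    (3 : ℂ) ^ Fintype.card κ *
      ∑ x : ι → ZMod 3, star (φ (Sum.elim x y)) * ψ (Sum.elim x y') =
      if y = y' then star φ ⬝ᵥ ψ else 0 := by
  have split : ∀ f : (ι ⊕ κ → ZMod 3) → ℂ, ∑ z, f z = ∑ q : κ → ZMod 3, ∑ x : ι → ZMod 3,
      f (Sum.elim x q) := by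
    intro f
    rw [← (Equiv.sumArrowEquivProdArrow ι κ (ZMod 3)).symm.sum_comp, Fintype.sum_prod_type_right]
    rfl
  set G : (κ → ZMod 3) → (κ → ZMod 3) → ℂ :=
    fun q q' => ∑ x : ι → ZMod 3, star (φ (Sum.elim x q)) * ψ (Sum.elim x q') with hG
  -- Matrix elements of Pauli operators of the receiver alone are Fourier sums of the reduced matrix
  -- `G`.
  have h1 : ∀ r : Vec κ, star φ ⬝ᵥ (pauliMat 0 (join (0 : Vec ι) r).1 (join (0 : Vec ι) r).2 *ᵥ ψ) =
      ∑ q, phase (r.2 ⬝ᵥ q) * G (q + r.1) q := by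
    intro r
    have h2 : ∀ z, (pauliMat 0 (join (0 : Vec ι) r).1 (join (0 : Vec ι) r).2 *ᵥ ψ) z =
        phase ((join (0 : Vec ι) r).2 ⬝ᵥ (z - (join (0 : Vec ι) r).1)) *
          ψ (z - (join (0 : Vec ι) r).1) := by
      intro z
      rw [Matrix.mulVec, dotProduct, Finset.sum_eq_single (z - (join (0 : Vec ι) r).1)]
      · rw [pauliMat_apply, if_pos (by simp), zero_add]
      · intro w _ hw
        rw [pauliMat_apply, if_neg, zero_mul]
        rintro rfl
        simp at hw
      · exact fun h => absurd (Finset.mem_univ _) h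
    rw [dotProduct, split, ← Equiv.sum_comp (Equiv.addRight r.1)]
    refine Finset.sum_congr rfl fun q _ => ?_
    rw [hG, Finset.mul_sum]
    refine Finset.sum_congr rfl fun x _ => ?_
    have h3 : (Sum.elim x (q + r.1) - (join (0 : Vec ι) r).1 : ι ⊕ κ → ZMod 3) = Sum.elim x q := by
      ext i; cases i <;> simp [join]
    rw [Equiv.coe_addRight, h2, h3]
    simp only [join, Pi.star_apply]
    rw [show (Sum.elim (0 : Vec ι).2 r.2 ⬝ᵥ Sum.elim x q) = r.2 ⬝ᵥ q by simp]
    ring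
  -- Since the receiver's parts of `W` are everything, some stabilizer element fails to commute with
  -- the operator of `r`.
  have h4 : ∀ r : Vec κ, r ≠ 0 → ∑ q, phase (r.2 ⬝ᵥ q) * G (q + r.1) q = 0 := by
    intro r hr
    have : ¬ ∀ r', symp r r' = 0 := fun h => hr (eq_zero_of_symp r h)
    push Not at this
    obtain ⟨r', hr'⟩ := this
    obtain ⟨w, hw⟩ := hsurj r'
    rw [← h1]
    refine star_dotProduct_pauliMat_eq_zero (v := join (0 : Vec ι) r) hw ?_ 0 hφ hψ
    rwa [symp_join, symp_zero_left, zero_add]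
  have h5 : ∑ q, G q q = star φ ⬝ᵥ ψ := by
    rw [dotProduct, split]; rfl
  -- Fourier inversion in the Z label, at fixed shift `y - y'`, recovers a single entry of `G`.
  have h6 : ∑ b : κ → ZMod 3, phase (-(b ⬝ᵥ y')) *
      ∑ q, phase (b ⬝ᵥ q) * G (q + (y - y')) q = (3 : ℂ) ^ Fintype.card κ * G y y' := by
    simp_rw [Finset.mul_sum]
    rw [Finset.sum_comm, Finset.sum_eq_single y']
    · have : ∀ b : κ → ZMod 3, phase (-(b ⬝ᵥ y')) * (phase (b ⬝ᵥ y') * G (y' + (y - y')) y') =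
          G y y' := by
        intro b
        rw [← mul_assoc, ← phase_add, neg_add_cancel, phase_zero, one_mul, add_sub_cancel]
      rw [Finset.sum_congr rfl fun b _ => this b]
      simp [ZMod.card]
    · intro q _ hq
      have : ∀ b : κ → ZMod 3, phase (-(b ⬝ᵥ y')) * (phase (b ⬝ᵥ q) * G (q + (y - y')) q) =
          phase ((q - y') ⬝ᵥ b) * G (q + (y - y')) q := by
        intro b
        rw [← mul_assoc, ← phase_add, sub_dotProduct, dotProduct_comm q, dotProduct_comm y']
        congr 2; ring
      rw [Finset.sum_congr rfl fun b _ => this b, ← Finset.sum_mul, sum_phase,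
        if_neg (sub_ne_zero.mpr hq), zero_mul]
    · exact fun h => absurd (Finset.mem_univ _) h
  rw [← h6]
  -- By `h4` only the label 0 survives, and it occurs just when `y = y'`.
  split_ifs with h
  · subst h
    rw [Finset.sum_eq_single 0]
    · simp [phase_zero, h5]
    · intro b _ hb
      have := h4 (y - y, b) (fun h => hb (congrArg Prod.snd h))
      simp only at this
      rw [this, mul_zero]
    · exact fun h => absurd (Finset.mem_univ _) h
  · refine Finset.sum_eq_zero fun b _ => ?_
    have := h4 (y - y', b) (fun h' => h (sub_eq_zero.mp (congrArg Prod.fst h')))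
    simp only at this
    rw [this, mul_zero]

end Surjective

/-- A subspace of states has an orthonormal basis indexed by any type of the right size. -/
theorem exists_orthonormal_basis {α : Type} [Fintype α] [DecidableEq α]
    (Q : Submodule ℂ (State ι)) (h : Module.finrank ℂ Q = Fintype.card α) :
    ∃ φ : α → State ι, (∀ s, φ s ∈ Q) ∧
      (∀ s s', star (φ s) ⬝ᵥ φ s' = if s = s' then 1 else 0) ∧
      ∀ χ ∈ Q, ∃ z : α → ℂ, χ = ∑ s, z s • φ s := by
  -- Pass to `EuclideanSpace`, where the inner product is the form `star φ ⬝ᵥ ψ`.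
  set e := WithLp.linearEquiv 2 ℂ (State ι) with he
  set Q' : Submodule ℂ (EuclideanSpace ℂ (ι → ZMod 3)) := Q.comap e.toLinearMap with hQ'
  have hQ : Module.finrank ℂ Q' = Fintype.card α := by
    rw [← h]
    exact (LinearEquiv.ofSubmodule' e Q).finrank_eq
  set b := (stdOrthonormalBasis ℂ Q').reindex (finCongr hQ |>.trans (Fintype.equivFin α).symm)
  refine ⟨fun s => e (b s), fun s => (b s).2, fun s s' => ?_, fun χ hχ => ?_⟩
  · have h1 := orthonormal_iff_ite.mp b.orthonormal s s'
    rw [← h1, Submodule.coe_inner, EuclideanSpace.inner_eq_star_dotProduct, dotProduct_comm]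
    rfl
  · have hχ' : e.symm χ ∈ Q' := by simpa [hQ'] using hχ
    refine ⟨b.repr ⟨e.symm χ, hχ'⟩, ?_⟩
    have h1 := congrArg (fun v : Q' => e v.1) (b.sum_repr ⟨e.symm χ, hχ'⟩)
    simp only [Submodule.coe_sum, Submodule.coe_smul, map_sum, map_smul,
      LinearEquiv.apply_symm_apply] at h1
    exact h1.symm

/-- A subspace of states of the joint register whose receiver's part is maximally mixed has an
isometric encoder that acts on the sender's side only. -/
theorem exists_isometry_eaEncode {n k c : ℕ} (Q : Submodule ℂ (State (Fin n ⊕ Fin c)))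
    (hdim : Module.finrank ℂ Q = 3 ^ k)
    (hmix : ∀ φ ∈ Q, ∀ ψ ∈ Q, ∀ y y' : Fin c → ZMod 3, (3 : ℂ) ^ c *
      ∑ x : Fin n → ZMod 3, star (φ (Sum.elim x y)) * ψ (Sum.elim x y') =
      if y = y' then star φ ⬝ᵥ ψ else 0) :
    ∃ V : Matrix (Fin n → ZMod 3) ((Fin k → ZMod 3) × (Fin c → ZMod 3)) ℂ,
      Vᴴ * V = 1 ∧ (Q : Set (State (Fin n ⊕ Fin c))) = Set.range (eaEncode V) := by
  obtain ⟨φ, hφ, horth, hspan⟩ := exists_orthonormal_basis (α := Fin k → ZMod 3) Q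
    (by rw [hdim]; simp [ZMod.card])
  obtain ⟨r, hr⟩ : ∃ r : ℂ, r = (Real.sqrt (3 ^ c) : ℝ) := ⟨_, rfl⟩
  have hs : r * r = 3 ^ c := by
    rw [hr, ← Complex.ofReal_mul, Real.mul_self_sqrt (by positivity)]
    push_cast; rfl
  have hs0 : r ≠ 0 := by
    intro h
    rw [h, zero_mul] at hs
    exact pow_ne_zero c (by norm_num) hs.symm
  -- Column `(s, y)` is the slice of the basis state `φ s` at receiver value `y`, rescaled by `√(3 ^
  -- c)` to undo the normalization of Φ. Maximal mixedness is orthonormality of these columns.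
  obtain ⟨V, hV⟩ : ∃ V : Matrix (Fin n → ZMod 3) ((Fin k → ZMod 3) × (Fin c → ZMod 3)) ℂ,
      ∀ x s y, V x (s, y) = r * φ s (Sum.elim x y) :=
    ⟨Matrix.of fun x p => r * φ p.1 (Sum.elim x p.2), fun _ _ _ => rfl⟩
  have henc : ∀ ψ : State (Fin k), eaEncode V ψ = ∑ s, ψ s • φ s := by
    intro ψ
    ext x
    simp only [eaEncode]
    rw [← hr, Finset.sum_apply, Finset.mul_sum]
    refine Finset.sum_congr rfl fun s _ => ?_
    have : Sum.elim (x ∘ Sum.inl) (x ∘ Sum.inr) = x := Sum.elim_comp_inl_inr x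
    simp only [hV, this, Pi.smul_apply, smul_eq_mul]
    rw [mul_assoc, inv_mul_cancel_left₀ hs0, mul_comm]
  refine ⟨V, ?_, ?_⟩
  · ext ⟨s, y⟩ ⟨s', y'⟩
    have h1 := hmix _ (hφ s) _ (hφ s') y y'
    rw [← hs, horth, mul_assoc, Finset.mul_sum, Finset.mul_sum] at h1
    rw [Matrix.mul_apply, Matrix.one_apply]
    have h2 : (if (s, y) = (s', y') then (1 : ℂ) else 0) =
        if y = y' then if s = s' then 1 else 0 else 0 := by
      by_cases hy : y = y' <;> by_cases hs : s = s' <;> simp [hy, hs]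
    rw [h2, ← h1]
    refine Finset.sum_congr rfl fun x _ => ?_
    rw [Matrix.conjTranspose_apply, hV, hV, star_mul', hr, Complex.star_def, Complex.conj_ofReal]
    ring
  · ext χ
    constructor
    · intro hχ
      obtain ⟨z, rfl⟩ := hspan χ hχ
      exact ⟨z, henc z⟩
    · rintro ⟨ψ, rfl⟩
      rw [henc]
      exact Submodule.sum_mem _ fun s _ => Submodule.smul_mem _ _ (hφ s)

/-- The entanglement-assisted code of an isotropic subspace whose projection to the receiver's
qutrits is onto. -/
theorem eaStabilizes_fullGroup {n k c l d : ℕ}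
    {W : Submodule (ZMod 3) (Vec (Fin n ⊕ Fin c))} (hW : IsIsotropic W)
    (hsurj : ∀ r : Vec (Fin c), ∃ v : Vec (Fin n), join v r ∈ W)
    (hn : k + c + l = n) (hcard : Nat.card W = 3 ^ (l + 2 * c))
    (hd : IsLeast {w | ∃ v : Vec (Fin n), join v (0 : Vec (Fin c)) ∈ sympCompl W ∧
      join v (0 : Vec (Fin c)) ∉ W ∧ wt v = w} d) :
    EAStabilizes (fullGroup (senderPart W)) k d c where
  le_pauliGroup := fullGroup_le_pauliGroup _
  size := by
    refine ⟨l, hn, ?_, ?_⟩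
    · have h := card_senderPart_inf hW hsurj
      rw [isotropicPart_fullGroup, projCard_fullGroup]
      rw [hcard, Nat.card_prod, Nat.card_fun, Nat.card_zmod, Nat.card_fin, ← pow_add, ← two_mul,
        pow_add] at h
      exact Nat.eq_of_mul_eq_mul_right (by positivity) h
    · rw [projCard_fullGroup, card_senderPart hW hsurj, hcard]
  distance := by
    rw [logicalWeights_fullGroup]
    convert hd using 3 with w
    refine exists_congr fun v => ⟨?_, ?_⟩
    -- Within the complement, membership in `senderPart W` and membership of `join v 0` in `W`
    -- agree.
    · rintro ⟨h1, h2, h3⟩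
      exact ⟨mem_sympCompl_senderPart.mp h1, fun h => h2 ⟨0, h⟩, h3⟩
    · rintro ⟨h1, h2, h3⟩
      have h1' := mem_sympCompl_senderPart.mpr h1
      exact ⟨h1', fun h => h2 ((mem_senderPart_inf_iff hW hsurj).mp ⟨h, h1'⟩), h3⟩
  code := by
    refine ⟨weylGroup W hW, ⟨isStabilizer_weylGroup, ?_, ?_, ?_⟩, ?_, ?_⟩
    · intro t a b h
      -- Any phase would serve: `fullGroup` contains all of them.
      refine ⟨0, pauli_mem_fullGroup.mpr ⟨(a ∘ Sum.inr, b ∘ Sum.inr), ?_⟩⟩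
      have h1 := mem_of_pauli_mem_weylGroup h
      have : join (a ∘ Sum.inl, b ∘ Sum.inl) (a ∘ Sum.inr, b ∘ Sum.inr) = (a, b) := by
        ext i <;> cases i <;> rfl
      rwa [this]
    · intro s a b h
      obtain ⟨r, hr⟩ := pauli_mem_fullGroup.mp h
      exact ⟨weylPhase (join (a, b) r), r.1, r.2,
        (weyl_mem_weylGroup (v := join (a, b) r)).mpr hr⟩
    · rw [card_weylGroup, projCard_fullGroup, card_senderPart hW hsurj]
    · refine exists_isometry_eaEncode _ ?_ fun φ hφ ψ hψ y y' => ?_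
      · have h := finrank_fixedSpace_mul_card (W := W) (hW := hW)
        have h' : (3 : ℕ) ^ (n + c) = 3 ^ k * 3 ^ (l + 2 * c) := by
          rw [← hn, ← pow_add]; congr 1; ring
        rw [hcard, Fintype.card_sum, Fintype.card_fin, Fintype.card_fin, h'] at h
        exact Nat.eq_of_mul_eq_mul_right (by positivity) h
      · have h := sum_star_mul_fixed hW hsurj hφ hψ y y'
        rwa [Fintype.card_fin] at h
    · intro a b hab
      refine detects_weylGroup (v := join (a, b) (0 : Vec (Fin c))) (fun h => ?_) 0
      by_contra h'
      exact absurd (hd.2 ⟨(a, b), h, h', rfl⟩) (not_le.mpr hab)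

end Qutrit
end

/-! ### Symplectic encoders, gluing and appending -/

noncomputable section
namespace Qutrit

variable {ι κ : Type} [Fintype ι] [DecidableEq ι] [Fintype κ] [DecidableEq κ]

/-- Pulling vectors of the phase space back along a map of registers. -/
def pull {ι κ : Type} (f : κ → ι) : Vec ι →ₗ[ZMod 3] Vec κ where
  toFun v := (v.1 ∘ f, v.2 ∘ f)
  map_add' _ _ := rfl
  map_smul' _ _ := rfl

theorem symp_pull_equiv (e : κ ≃ ι) (u v : Vec ι) : symp (pull e u) (pull e v) = symp u v := by
  simp only [symp, dotProduct, pull, LinearMap.coe_mk, AddHom.coe_mk, Function.comp]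
  rw [e.sum_comp fun i => u.2 i * v.1 i, e.sum_comp fun i => u.1 i * v.2 i]

theorem wt_pull_equiv (e : κ ≃ ι) (v : Vec ι) : wt (pull e v) = wt v := by
  rw [wt_eq_sum, wt_eq_sum, ← e.sum_comp]
  rfl

theorem symp_sum (u v : Vec (ι ⊕ κ)) :
    symp u v = symp (pull Sum.inl u) (pull Sum.inl v) + symp (pull Sum.inr u) (pull Sum.inr v) := by
  simp only [symp, dotProduct, pull, LinearMap.coe_mk, AddHom.coe_mk, Function.comp,
    Fintype.sum_sum_type]
  ring

/-- Complex conjugation of Pauli operators. -/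
def conjVec : Vec ι →ₗ[ZMod 3] Vec ι where
  toFun v := (v.1, -v.2)
  map_add' u v := by ext <;> simp; ring
  map_smul' t v := by ext <;> simp

theorem conjVec_conjVec (v : Vec ι) : conjVec (conjVec v) = v := by
  ext <;> simp [conjVec]

theorem symp_conjVec (u v : Vec ι) : symp (conjVec u) (conjVec v) = - symp u v := by
  simp [symp, conjVec]; ring

theorem conjVec_ne_zero {v : Vec ι} (h : v ≠ 0) : conjVec v ≠ 0 := fun h' =>
  h (by rw [← conjVec_conjVec v, h', map_zero])

variable {ν lam γ : Type} [Fintype ν] [DecidableEq ν] [Fintype lam] [DecidableEq lam]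
  [Fintype γ] [DecidableEq γ]

/-- An encoder, given by its action on the phase space: a symplectic map from a register that
consists of the ancillas `lam`, the sender's halves `γ` of the entangled pairs, and the information
qutrits `κ`. -/
def IsEncoder (enc : Vec lam × Vec γ × Vec κ →ₗ[ZMod 3] Vec ν) : Prop :=
  ∀ u v, symp (enc u) (enc v) = symp u.1 v.1 + symp u.2.1 v.2.1 + symp u.2.2 v.2.2

/-- The logical operator `u`, multiplied by the stabilizer element `t`. -/
def logical (enc : Vec lam × Vec γ × Vec κ →ₗ[ZMod 3] Vec ν) (t : lam → ZMod 3) (u : Vec κ) :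
    Vec ν := enc ((0, t), 0, u)

/-- An encoder into the register `ν` with ancillas `lam`, entangled pairs `γ` and information
qutrits `κ` such that nontrivial logical operators have weight at least `d`; the weight `d` is
attained by the logical operator `X(a₀)`. -/
def HasEncoder (ν lam γ κ : Type) [Fintype ν] [DecidableEq ν] [Fintype lam] [DecidableEq lam]
    [Fintype γ] [DecidableEq γ] [Fintype κ] [DecidableEq κ] (d : ℕ) (a₀ : κ → ZMod 3) : Prop :=
  Fintype.card ν = Fintype.card lam + Fintype.card γ + Fintype.card κ ∧
    ∃ enc : Vec lam × Vec γ × Vec κ →ₗ[ZMod 3] Vec ν, IsEncoder enc ∧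
      (∀ t u, u ≠ 0 → d ≤ wt (logical enc t u)) ∧ ∃ t, wt (logical enc t (a₀, 0)) = d

/-- A map that preserves a nondegenerate form has trivial kernel. -/
theorem IsEncoder.injective {enc : Vec lam × Vec γ × Vec κ →ₗ[ZMod 3] Vec ν}
    (h : IsEncoder enc) : Function.Injective enc := by
  rw [← LinearMap.ker_eq_bot, LinearMap.ker_eq_bot']
  intro u hu
  have key : ∀ v : Vec lam × Vec γ × Vec κ,
      symp u.1 v.1 + symp u.2.1 v.2.1 + symp u.2.2 v.2.2 = 0 := fun v => by
    rw [← h, hu, symp_zero_left]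
  refine Prod.ext (eq_zero_of_symp _ fun w => ?_) (Prod.ext (eq_zero_of_symp _ fun w => ?_)
    (eq_zero_of_symp _ fun w => ?_))
  · simpa [symp_zero_right] using key (w, 0, 0)
  · simpa [symp_zero_right] using key (0, w, 0)
  · simpa [symp_zero_right] using key (0, 0, w)

theorem IsEncoder.surjective {enc : Vec lam × Vec γ × Vec κ →ₗ[ZMod 3] Vec ν}
    (h : IsEncoder enc)
    (hc : Fintype.card ν = Fintype.card lam + Fintype.card γ + Fintype.card κ) :
    Function.Surjective enc := by
  refine ((Fintype.bijective_iff_injective_and_card enc).mpr ⟨h.injective, ?_⟩).2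
  simp only [Fintype.card_prod, Fintype.card_fun, ZMod.card, hc, pow_add]
  ring

/-- Write `v` as an image under `enc`. Pairing with the ancillas' Z operators kills its X part on
the ancillas, and pairing with all ebit operators kills its ebit part. -/
theorem IsEncoder.exists_logical {enc : Vec lam × Vec γ × Vec κ →ₗ[ZMod 3] Vec ν}
    (h : IsEncoder enc)
    (hc : Fintype.card ν = Fintype.card lam + Fintype.card γ + Fintype.card κ) (v : Vec ν)
    (hv : ∀ t r, symp v (enc ((0, t), r, 0)) = 0) : ∃ t u, v = logical enc t u := by
  obtain ⟨⟨x, y, u⟩, rfl⟩ := h.surjective hc v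
  have h1 : x.1 = 0 := by
    ext i
    have := hv (Pi.single i 1) 0
    rw [h] at this
    simpa [symp_zero_right, symp_single_snd] using this
  have h2 : y = 0 := by
    refine eq_zero_of_symp y fun r => ?_
    have := hv 0 r
    rw [h] at this
    have h0 : ((0, 0) : Vec lam) = 0 := rfl
    simpa [symp_zero_right, h0] using this
  exact ⟨x.2, u, by rw [logical, ← h1, ← h2]⟩

/-- The isotropic subspace of the joint register of sender and receiver that belongs to an
encoder. -/
def jointStabilizer (enc : Vec lam × Vec γ × Vec κ →ₗ[ZMod 3] Vec ν) :
    Submodule (ZMod 3) (Vec (ν ⊕ γ)) where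
  carrier := {x | ∃ t r, x = join (enc ((0, t), r, 0)) (conjVec r)}
  add_mem' := by
    rintro _ _ ⟨t, r, rfl⟩ ⟨t', r', rfl⟩
    refine ⟨t + t', r + r', ?_⟩
    rw [← join_add, ← map_add, ← map_add]
    simp
  zero_mem' := ⟨0, 0, by
    have : (((0, 0), 0, 0) : Vec lam × Vec γ × Vec κ) = 0 := rfl
    rw [this, map_zero, map_zero]
    ext i <;> cases i <;> rfl⟩
  smul_mem' := by
    rintro s _ ⟨t, r, rfl⟩
    refine ⟨s • t, s • r, ?_⟩
    rw [← join_smul, ← map_smul, ← map_smul]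
    simp

theorem symp_zero_fst (t t' : ι → ZMod 3) : symp ((0, t) : Vec ι) (0, t') = 0 := by simp [symp]

/-- Conjugation on the receiver's halves negates the form and cancels the sender's ebit
contribution; the Z operators of the ancillas commute. -/
theorem isIsotropic_jointStabilizer {enc : Vec lam × Vec γ × Vec κ →ₗ[ZMod 3] Vec ν}
    (h : IsEncoder enc) : IsIsotropic (jointStabilizer enc) := by
  rintro _ ⟨t, r, rfl⟩ _ ⟨t', r', rfl⟩
  rw [symp_join, h, symp_conjVec]
  simp [symp_zero_fst, symp_zero_left]

theorem card_jointStabilizer {enc : Vec lam × Vec γ × Vec κ →ₗ[ZMod 3] Vec ν}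
    (h : IsEncoder enc) :
    Nat.card (jointStabilizer enc) = 3 ^ (Fintype.card lam + 2 * Fintype.card γ) := by
  have : Function.Bijective (fun p : (lam → ZMod 3) × Vec γ =>
      (⟨join (enc ((0, p.1), p.2, 0)) (conjVec p.2), p.1, p.2, rfl⟩ : jointStabilizer enc)) := by
    constructor
    · rintro ⟨t, r⟩ ⟨t', r'⟩ h'
      have := h.injective (join_inj.mp (congrArg Subtype.val h')).1
      simp only [Prod.mk.injEq, true_and, and_true] at this
      rw [this.1, this.2]
    · rintro ⟨_, t, r, rfl⟩
      exact ⟨(t, r), rfl⟩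
  rw [← Nat.card_congr (Equiv.ofBijective _ this)]
  simp only [Nat.card_eq_fintype_card, Fintype.card_prod, Fintype.card_fun, ZMod.card]
  rw [← pow_add, ← pow_add, two_mul]

/-- By injectivity of `enc`, the stabilizer contributes no information component, so nontrivial
logical operators are those with `u ≠ 0`. -/
theorem logical_mem_jointStabilizer_iff {enc : Vec lam × Vec γ × Vec κ →ₗ[ZMod 3] Vec ν}
    (h : IsEncoder enc) {t : lam → ZMod 3} {u : Vec κ} :
    join (logical enc t u) (0 : Vec γ) ∈ jointStabilizer enc ↔ u = 0 := by
  constructor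
  · rintro ⟨t', r, h'⟩
    have := h.injective (join_inj.mp h').1
    simp only [Prod.mk.injEq, true_and] at this
    exact this.2.2
  · rintro rfl
    exact ⟨t, 0, by rw [map_zero]; rfl⟩

theorem logical_mem_sympCompl {enc : Vec lam × Vec γ × Vec κ →ₗ[ZMod 3] Vec ν}
    (h : IsEncoder enc) (t : lam → ZMod 3) (u : Vec κ) :
    join (logical enc t u) (0 : Vec γ) ∈ sympCompl (jointStabilizer enc) := by
  rintro _ ⟨t', r, rfl⟩
  rw [symp_join, logical, h]
  simp [symp_zero_fst, symp_zero_left, symp_zero_right]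

/-- An encoder yields an entanglement-assisted code. -/
theorem HasEncoder.exists_eaStabilizes {n k c d : ℕ} {a₀ : Fin k → ZMod 3} (ha : a₀ ≠ 0)
    (h : HasEncoder (Fin n) lam (Fin c) (Fin k) d a₀) :
    ∃ S : Subgroup (Op (Fin n))ˣ, EAStabilizes S k d c := by
  obtain ⟨hc, enc, h, hd, t₀, ht₀⟩ := h
  have ha' : ((a₀, 0) : Vec (Fin k)) ≠ 0 := fun h => ha (congrArg Prod.fst h)
  refine ⟨_, eaStabilizes_fullGroup (l := Fintype.card lam) (isIsotropic_jointStabilizer h)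
    -- The receiver's part `r` comes from `conjVec r` on the ebits, conjugation being an involution.
    (fun r => ⟨enc ((0, 0), conjVec r, 0), 0, conjVec r, by rw [conjVec_conjVec]⟩) ?_ ?_
    ⟨⟨logical enc t₀ (a₀, 0), logical_mem_sympCompl h _ _,
      fun h' => ha' ((logical_mem_jointStabilizer_iff h).mp h'), ht₀⟩, ?_⟩⟩
  · simp only [Fintype.card_fin] at hc
    omega
  · simpa using card_jointStabilizer h
  · rintro _ ⟨v, hv, hv', rfl⟩
    obtain ⟨t, u, rfl⟩ := h.exists_logical hc v fun t r => by
      simpa [symp_join, symp_zero_left] using hv _ ⟨t, r, rfl⟩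
    exact hd t u fun hu => hv' ((logical_mem_jointStabilizer_iff h).mpr hu)

/-- An encoder that uses no entanglement yields a stabilizer code. -/
theorem HasEncoder.exists_stabilizes {m k d : ℕ} {a₀ : Fin k → ZMod 3} (ha : a₀ ≠ 0)
    [IsEmpty γ] (h : HasEncoder (Fin m) lam γ (Fin k) d a₀) :
    ∃ S : Subgroup (Op (Fin m))ˣ, Stabilizes S k d := by
  obtain ⟨hc, enc, h, hd, t₀, ht₀⟩ := h
  have ha' : ((a₀, 0) : Vec (Fin k)) ≠ 0 := fun h => ha (congrArg Prod.fst h)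
  -- With `γ` empty the receiver's phase space is a point, and the joint register is the sender's.
  have hsymp : ∀ v w : Vec (Fin m), symp (join v (0 : Vec γ)) (join w (0 : Vec γ)) = symp v w :=
    fun v w => by rw [symp_join, symp_zero_left, add_zero]
  have hmem : ∀ v, v ∈ senderPart (jointStabilizer enc) ↔
      join v (0 : Vec γ) ∈ jointStabilizer enc := fun v =>
    ⟨fun ⟨r, hr⟩ => Subsingleton.elim r 0 ▸ hr, fun h => ⟨0, h⟩⟩
  have hsurj : ∀ r : Vec γ, ∃ v : Vec (Fin m), join v r ∈ jointStabilizer enc := fun r =>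
    ⟨_, 0, r, by rw [Subsingleton.elim (conjVec r) r]⟩
  have hiso := isIsotropic_jointStabilizer h
  refine ⟨_, stabilizes_weylGroup (W := senderPart (jointStabilizer enc)) (r := Fintype.card lam)
    (fun u hu v hv => ?_) ?_ ?_
    ⟨⟨logical enc t₀ (a₀, 0), mem_sympCompl_senderPart.mpr (logical_mem_sympCompl h _ _),
      fun h' => ha' ((logical_mem_jointStabilizer_iff h).mp ((hmem _).mp h')), ht₀⟩, ?_⟩⟩
  · rw [← hsymp]
    exact hiso _ ((hmem u).mp hu) _ ((hmem v).mp hv)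
  · simp only [Fintype.card_fin, Fintype.card_eq_zero] at hc
    omega
  · rw [card_senderPart hiso hsurj, card_jointStabilizer h, Fintype.card_eq_zero (α := γ)]
    rfl
  · rintro _ ⟨v, hv, hv', rfl⟩
    rw [mem_sympCompl_senderPart] at hv
    obtain ⟨t, u, rfl⟩ := h.exists_logical hc v fun t r => by
      simpa [symp_join, symp_zero_left] using hv _ ⟨t, r, rfl⟩
    exact hd t u fun hu => hv' ((hmem _).mpr ((logical_mem_jointStabilizer_iff h).mpr hu))

theorem HasEncoder.reindex {ν' γ' : Type} [Fintype ν'] [DecidableEq ν'] [Fintype γ']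
    [DecidableEq γ'] {d : ℕ} {a₀ : κ → ZMod 3} (h : HasEncoder ν lam γ κ d a₀) (e : ν' ≃ ν)
    (f : γ' ≃ γ) : HasEncoder ν' lam γ' κ d a₀ := by
  obtain ⟨hc, enc, h, hd, t₀, ht₀⟩ := h
  have hlog : ∀ t u, wt (logical (pull e ∘ₗ enc ∘ₗ
      LinearMap.prodMap LinearMap.id (LinearMap.prodMap (pull f.symm) LinearMap.id)) t u) =
      wt (logical enc t u) := by
    intro t u
    rw [← wt_pull_equiv e (logical enc t u)]
    simp [logical]
  refine ⟨by rw [Fintype.card_congr e, Fintype.card_congr f, hc], _, ?_,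
    fun t u hu => (hd t u hu).trans_eq (hlog t u).symm, t₀, (hlog _ _).trans ht₀⟩
  intro u v
  simp [symp_pull_equiv, h _ _]

/-- Juxtaposition as a linear map. -/
def joinMap (ι κ : Type) : Vec ι × Vec κ →ₗ[ZMod 3] Vec (ι ⊕ κ) where
  toFun p := join p.1 p.2
  map_add' p q := by ext i <;> cases i <;> rfl
  map_smul' t p := by ext i <;> cases i <;> rfl

/-- Gluing: two codes with the same number of information qutrits can be combined to one whose
logical operators act on both; the distances add, and so do the numbers of entangled pairs, up to
one additional pair for each information qutrit. -/
theorem HasEncoder.glue {ν₁ ν₂ lam₁ lam₂ γ₁ γ₂ : Type} [Fintype ν₁] [DecidableEq ν₁]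
    [Fintype ν₂] [DecidableEq ν₂] [Fintype lam₁] [DecidableEq lam₁] [Fintype lam₂]
    [DecidableEq lam₂] [Fintype γ₁] [DecidableEq γ₁] [Fintype γ₂] [DecidableEq γ₂]
    {d₁ d₂ : ℕ} {a₀ : κ → ZMod 3} (h₁ : HasEncoder ν₁ lam₁ γ₁ κ d₁ a₀)
    (h₂ : HasEncoder ν₂ lam₂ γ₂ κ d₂ a₀) :
    HasEncoder (ν₁ ⊕ ν₂) (lam₁ ⊕ lam₂) ((γ₁ ⊕ γ₂) ⊕ κ) κ (d₁ + d₂) a₀ := by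
  obtain ⟨hc₁, enc₁, h₁, hd₁, t₁, ht₁⟩ := h₁
  obtain ⟨hc₂, enc₂, h₂, hd₂, t₂, ht₂⟩ := h₂
  let anc := LinearMap.fst (ZMod 3) (Vec (lam₁ ⊕ lam₂)) (Vec ((γ₁ ⊕ γ₂) ⊕ κ) × Vec κ)
  let ebit := LinearMap.fst (ZMod 3) (Vec ((γ₁ ⊕ γ₂) ⊕ κ)) (Vec κ) ∘ₗ
    LinearMap.snd (ZMod 3) (Vec (lam₁ ⊕ lam₂)) _
  let info := LinearMap.snd (ZMod 3) (Vec ((γ₁ ⊕ γ₂) ⊕ κ)) (Vec κ) ∘ₗ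
    LinearMap.snd (ZMod 3) (Vec (lam₁ ⊕ lam₂)) _
  let p₁ := (pull Sum.inl ∘ₗ anc).prod ((pull (Sum.inl ∘ Sum.inl) ∘ₗ ebit).prod
    (conjVec ∘ₗ (info + pull Sum.inr ∘ₗ ebit)))
  let p₂ := (pull Sum.inr ∘ₗ anc).prod ((pull (Sum.inl ∘ Sum.inr) ∘ₗ ebit).prod
    (conjVec ∘ₗ (info - pull Sum.inr ∘ₗ ebit)))
  have hlog : ∀ t u, logical (joinMap ν₁ ν₂ ∘ₗ (enc₁ ∘ₗ p₁).prod (enc₂ ∘ₗ p₂)) t u =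
      join (logical enc₁ (t ∘ Sum.inl) (conjVec u)) (logical enc₂ (t ∘ Sum.inr) (conjVec u)) := by
    intro t u
    simp [logical, joinMap, p₁, p₂, anc, ebit, info]
    rfl
  -- Conjugation fixes X-type labels. Hence both blocks attain their minimum at the same logical
  -- operator, and the sum of distances is attained.
  have ha : conjVec ((a₀, 0) : Vec κ) = (a₀, 0) := by simp [conjVec]
  refine ⟨?_, joinMap ν₁ ν₂ ∘ₗ (enc₁ ∘ₗ p₁).prod (enc₂ ∘ₗ p₂), ?_, ?_, Sum.elim t₁ t₂, ?_⟩
  · simp only [Fintype.card_sum, hc₁, hc₂]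
    omega
  · intro u v
    have e1 : ∀ x y : Vec κ, symp (conjVec (u.2.2 + x)) (conjVec (v.2.2 + y)) +
        symp (conjVec (u.2.2 - x)) (conjVec (v.2.2 - y)) = symp x y + symp u.2.2 v.2.2 := by
      intro x y
      simp only [symp_conjVec, sub_eq_add_neg, symp_add_left, symp_add_right, symp_neg_right,
        symp_swap (-x), neg_neg]
      rw [symp_swap v.2.2 x, symp_swap y x]
      have h3 : (3 : ZMod 3) = 0 := rfl
      -- The cross terms have cancelled, leaving the factor -2, which is 1 modulo 3.
      linear_combination (-symp x y - symp u.2.2 v.2.2) * h3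
    have e2 := e1 (pull Sum.inr u.2.1) (pull Sum.inr v.2.1)
    change symp (join (enc₁ (p₁ u)) (enc₂ (p₂ u))) (join (enc₁ (p₁ v)) (enc₂ (p₂ v))) = _
    have q₁ : ∀ u, p₁ u = (pull Sum.inl u.1, pull Sum.inl (pull Sum.inl u.2.1),
      conjVec (u.2.2 + pull Sum.inr u.2.1)) := fun _ => rfl
    have q₂ : ∀ u, p₂ u = (pull Sum.inr u.1, pull Sum.inr (pull Sum.inl u.2.1),
      conjVec (u.2.2 - pull Sum.inr u.2.1)) := fun _ => rfl
    rw [symp_join, h₁, h₂, q₁, q₁, q₂, q₂, symp_sum u.1, symp_sum u.2.1, symp_sum (pull Sum.inl u.2.1)]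
    linear_combination e2
  · intro t u hu
    rw [hlog, wt_join]
    exact add_le_add (hd₁ _ _ (conjVec_ne_zero hu)) (hd₂ _ _ (conjVec_ne_zero hu))
  · rw [hlog, wt_join, ha, Sum.elim_comp_inl, Sum.elim_comp_inr, ht₁, ht₂]

/-- Appending qutrits that are halves of entangled pairs. -/
theorem HasEncoder.append {d : ℕ} {a₀ : κ → ZMod 3} (h : HasEncoder ν lam γ κ d a₀) :
    HasEncoder (ν ⊕ ι) lam (γ ⊕ ι) κ d a₀ := by
  obtain ⟨hc, enc, h, hd, t₀, ht₀⟩ := h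
  let enc' : Vec lam × Vec (γ ⊕ ι) × Vec κ →ₗ[ZMod 3] Vec (ν ⊕ ι) :=
    joinMap ν ι ∘ₗ (enc ∘ₗ LinearMap.prodMap LinearMap.id
      (LinearMap.prodMap (pull Sum.inl) LinearMap.id)).prod
      (pull Sum.inr ∘ₗ LinearMap.fst (ZMod 3) _ _ ∘ₗ LinearMap.snd (ZMod 3) _ _)
  have hlog : ∀ t u, wt (logical enc' t u) = wt (logical enc t u) := by
    intro t u
    have h1 : logical enc' t u = join (logical enc t u) (0 : Vec ι) := rfl
    have h2 : wt (0 : Vec ι) = 0 := by simp [wt_eq_sum]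
    rw [h1, wt_join, h2, add_zero]
  refine ⟨?_, enc', ?_, fun t u hu => (hd t u hu).trans_eq (hlog t u).symm, t₀,
    (hlog _ _).trans ht₀⟩
  · simp only [Fintype.card_sum, hc]
    omega
  · intro u v
    change symp (join (enc (u.1, pull Sum.inl u.2.1, u.2.2)) (pull Sum.inr u.2.1))
      (join (enc (v.1, pull Sum.inl v.2.1, v.2.2)) (pull Sum.inr v.2.1)) = _
    rw [symp_join, h, symp_sum u.2.1]
    ring

end Qutrit
end

/-! ### Vectors over 𝔽₃ as pairs of bit masks -/

noncomputable section
namespace Qutrit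

variable {ι κ : Type} [Fintype ι] [DecidableEq ι] [Fintype κ] [DecidableEq κ]

theorem symp_sum_left {α : Type} (s : Finset α) (f : α → Vec ι) (w : Vec ι) :
    symp (∑ i ∈ s, f i) w = ∑ i ∈ s, symp (f i) w := by
  classical
  induction s using Finset.induction_on with
  | empty => simp [symp_zero_left]
  | insert a s ha ih => rw [Finset.sum_insert ha, Finset.sum_insert ha, symp_add_left, ih]

theorem symp_sum_right {α : Type} (s : Finset α) (f : α → Vec ι) (w : Vec ι) :
    symp w (∑ i ∈ s, f i) = ∑ i ∈ s, symp w (f i) := by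
  rw [symp_swap, symp_sum_left, ← Finset.sum_neg_distrib]
  exact Finset.sum_congr rfl fun i _ => (symp_swap _ _).symm

/-- The linear map that sends the standard symplectic basis to the vectors `X i`, `Z i`. -/
def frameMap (X Z : κ → Vec ι) : Vec κ →ₗ[ZMod 3] Vec ι where
  toFun u := ∑ i, (u.1 i • X i + u.2 i • Z i)
  map_add' u v := by
    rw [← Finset.sum_add_distrib]
    refine Finset.sum_congr rfl fun i _ => ?_
    simp only [Prod.fst_add, Prod.snd_add, Pi.add_apply, add_smul]
    abel
  map_smul' t u := by
    rw [Finset.smul_sum]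
    refine Finset.sum_congr rfl fun i _ => ?_
    simp [mul_smul]

theorem frameMap_apply (X Z : κ → Vec ι) (u : Vec κ) :
    frameMap X Z u = ∑ i, (u.1 i • X i + u.2 i • Z i) := rfl

theorem symp_frameMap {X Z : κ → Vec ι} (hX : ∀ i j, symp (X i) (X j) = 0)
    (hZ : ∀ i j, symp (Z i) (Z j) = 0)
    (hZX : ∀ i j, symp (Z i) (X j) = if i = j then 1 else 0) (u v : Vec κ) :
    symp (frameMap X Z u) (frameMap X Z v) = symp u v := by
  have hXZ : ∀ i j, symp (X i) (Z j) = if i = j then -1 else 0 := fun i j => by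
    rw [symp_swap, hZX]
    by_cases h : i = j <;> simp [h, eq_comm]
  rw [frameMap_apply, frameMap_apply, symp_sum_left]
  simp only [symp_sum_right, symp_add_left, symp_add_right, symp_smul_left, symp_smul_right,
    hX, hZ, hZX, hXZ, mul_ite, mul_zero, zero_add, add_zero, Finset.sum_add_distrib,
    Finset.sum_ite_eq, Finset.mem_univ, if_true]
  simp only [symp, dotProduct, mul_neg, mul_one, Finset.sum_neg_distrib]
  simp only [mul_comm]
  ring

/-- The digit at position `j` of the ternary word stored in a pair of bit masks. -/
def trit (m : ℕ × ℕ) (j : ℕ) : ℕ := (m.1.testBit j).toNat + 2 * (m.2.testBit j).toNat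

/-- The vector of the phase space of `n` qutrits stored in a pair of bit masks. -/
def maskVec (n : ℕ) (m : ℕ × ℕ) : Vec (Fin n) :=
  (fun j => (trit m j : ZMod 3), fun j => (trit m (n + j) : ZMod 3))

/-- `f 0 + ⋯ + f (m - 1)` -/
def sumLt (m : ℕ) (f : ℕ → ℕ) : ℕ := Nat.rec 0 (fun i s => s + f i) m

/-- The conjunction of `f 0, …, f (m - 1)`. -/
def allLt (m : ℕ) (f : ℕ → Bool) : Bool := Nat.rec true (fun i s => s && f i) m

theorem sumLt_eq (m : ℕ) (f : ℕ → ℕ) : sumLt m f = ∑ i : Fin m, f i := by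
  induction m with
  | zero => rfl
  | succ m ih => rw [Fin.sum_univ_castSucc]; exact congrArg (· + f m) ih

theorem allLt_iff (m : ℕ) (f : ℕ → Bool) : allLt m f = true ↔ ∀ i < m, f i = true := by
  induction m with
  | zero => simp [allLt]
  | succ m ih =>
    have : allLt (m + 1) f = (allLt m f && f m) := rfl
    rw [this, Bool.and_eq_true, ih]
    refine ⟨fun h i hi => ?_, fun h => ⟨fun i hi => h i (by omega), h m (by omega)⟩⟩
    rcases Nat.lt_succ_iff_lt_or_eq.mp hi with h' | rfl
    · exact h.1 i h'
    · exact h.2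

/-- The symplectic form on stored vectors, up to multiples of three. -/
def maskSymp (n : ℕ) (a b : ℕ × ℕ) : ℕ :=
  sumLt n fun j => trit a (n + j) * trit b j + 2 * (trit a j * trit b (n + j))

theorem cast_maskSymp (n : ℕ) (a b : ℕ × ℕ) :
    (maskSymp n a b : ZMod 3) = symp (maskVec n a) (maskVec n b) := by
  have h2 : (2 : ZMod 3) = -1 := rfl
  simp only [maskSymp, sumLt_eq, symp, dotProduct, maskVec, Nat.cast_sum, Nat.cast_add,
    Nat.cast_mul, Nat.cast_ofNat, h2, Finset.sum_add_distrib, neg_mul, one_mul,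
    Finset.sum_neg_distrib, sub_eq_add_neg]

/-- The test that the stored vectors form a symplectic basis. -/
def gramCheck (n : ℕ) (X Z : List (ℕ × ℕ)) : Bool :=
  allLt n fun i => allLt n fun j =>
    maskSymp n (X.getD i 0) (X.getD j 0) % 3 == 0 && maskSymp n (Z.getD i 0) (Z.getD j 0) % 3 == 0
      && maskSymp n (Z.getD i 0) (X.getD j 0) % 3 == if i = j then 1 else 0

theorem gramCheck_spec {n : ℕ} {X Z : List (ℕ × ℕ)} (h : gramCheck n X Z = true) {i j : ℕ}
    (hi : i < n) (hj : j < n) :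
    symp (maskVec n (X.getD i 0)) (maskVec n (X.getD j 0)) = 0 ∧
    symp (maskVec n (Z.getD i 0)) (maskVec n (Z.getD j 0)) = 0 ∧
    symp (maskVec n (Z.getD i 0)) (maskVec n (X.getD j 0)) = if i = j then 1 else 0 := by
  have h1 := (allLt_iff _ _).mp ((allLt_iff _ _).mp h i hi) j hj
  simp only [Bool.and_eq_true, beq_iff_eq] at h1
  simp only [← cast_maskSymp]
  refine ⟨?_, ?_, ?_⟩
  · rw [← ZMod.natCast_mod, h1.1.1, Nat.cast_zero]
  · rw [← ZMod.natCast_mod, h1.1.2, Nat.cast_zero]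
  · rw [← ZMod.natCast_mod, h1.2]
    split_ifs <;> simp

/-- The pair of entries of a vector at position `p`. -/
def entry {n : ℕ} (v : Vec (Fin n)) (p : ℕ) : ZMod 3 × ZMod 3 :=
  if h : p < n then (v.1 ⟨p, h⟩, v.2 ⟨p, h⟩) else 0

theorem entry_add {n : ℕ} (u v : Vec (Fin n)) (p : ℕ) :
    entry (u + v) p = entry u p + entry v p := by
  unfold entry
  split_ifs
  · rfl
  · rw [add_zero]

theorem entry_smul {n : ℕ} (t : ZMod 3) (v : Vec (Fin n)) (p : ℕ) :
    entry (t • v) p = t • entry v p := by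
  unfold entry
  split_ifs
  · rfl
  · rw [smul_zero]

/-- Systematic encoding: the `i`-th pair of rows is taken with the entries at position `p + i`. -/
def systematic {n : ℕ} : List ((ℕ × ℕ) × (ℕ × ℕ)) → ℕ → Vec (Fin n) →ₗ[ZMod 3] Vec (Fin n)
  | [], _ => 0
  | r :: rs, p =>
    { toFun := fun v => (entry v p).1 • maskVec n r.1 + (entry v p).2 • maskVec n r.2
      map_add' := fun u v => by
        simp only [entry_add, Prod.fst_add, Prod.snd_add, add_smul]
        abel
      map_smul' := fun t v => by
        simp only [entry_smul, Prod.smul_fst, Prod.smul_snd, smul_eq_mul, mul_smul, smul_add,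
          RingHom.id_apply] } + systematic rs (p + 1)

theorem systematic_cons {n : ℕ} (r : (ℕ × ℕ) × (ℕ × ℕ)) (rs : List ((ℕ × ℕ) × (ℕ × ℕ))) (p : ℕ)
    (v : Vec (Fin n)) : systematic (r :: rs) p v =
      (entry v p).1 • maskVec n r.1 + (entry v p).2 • maskVec n r.2 + systematic rs (p + 1) v := rfl

/-- The entry at position `q` of the systematic encoding of a stored vector. -/
def systematicTrit (n : ℕ) : List ((ℕ × ℕ) × (ℕ × ℕ)) → ℕ → ℕ × ℕ → ℕ → ℕ
  | [], _, _, _ => 0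
  | r :: rs, p, g, q =>
    trit g p * trit r.1 q + trit g (n + p) * trit r.2 q + systematicTrit n rs (p + 1) g q

theorem cast_systematicTrit {n : ℕ} (rs : List ((ℕ × ℕ) × (ℕ × ℕ))) (p : ℕ) (g : ℕ × ℕ)
    (hp : p + rs.length ≤ n) (q : Fin n) :
    (systematicTrit n rs p g q : ZMod 3) = (systematic rs p (maskVec n g)).1 q ∧
    (systematicTrit n rs p g (n + q) : ZMod 3) = (systematic rs p (maskVec n g)).2 q := by
  induction rs generalizing p with
  | nil => exact ⟨Nat.cast_zero, Nat.cast_zero⟩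
  | cons r rs ih =>
    simp only [List.length_cons] at hp
    obtain ⟨h1, h2⟩ := ih (p + 1) (by omega)
    have he : entry (maskVec n g) p = ((trit g p : ZMod 3), (trit g (n + p) : ZMod 3)) := by
      rw [entry, dif_pos (by omega)]
      rfl
    rw [systematic_cons, he]
    simp only [systematicTrit, Nat.cast_add, Nat.cast_mul, h1, h2]
    exact ⟨rfl, rfl⟩

/-- The test that a stored vector is its own systematic encoding. -/
def systematicCheck (n : ℕ) (rs : List ((ℕ × ℕ) × (ℕ × ℕ))) (p : ℕ) (g : ℕ × ℕ) : Bool :=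
  allLt (n + n) fun q => systematicTrit n rs p g q % 3 == trit g q % 3

/-- The bound `hp` keeps the window inside the word, so that no entry is read by its default value.
-/
theorem systematicCheck_spec {n : ℕ} {rs : List ((ℕ × ℕ) × (ℕ × ℕ))} {p : ℕ} {g : ℕ × ℕ}
    (hp : p + rs.length ≤ n) (h : systematicCheck n rs p g = true) :
    systematic rs p (maskVec n g) = maskVec n g := by
  have h1 : ∀ q < n + n, (systematicTrit n rs p g q : ZMod 3) = trit g q := fun q hq => by
    have := (allLt_iff _ _).mp h q hq
    rw [beq_iff_eq] at this
    exact (ZMod.natCast_eq_natCast_iff' _ _ _).mpr this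
  refine Prod.ext (funext fun q => ?_) (funext fun q => ?_)
  · rw [← (cast_systematicTrit rs p g hp q).1, h1 _ (by omega)]
    rfl
  · rw [← (cast_systematicTrit rs p g hp q).2, h1 _ (by omega)]
    rfl

/-- First mask of the sum of two stored words. -/
def addFst (x y x' y' : ℕ) : ℕ :=
  Nat.xor (Nat.lor y y') (Nat.xor (Nat.lor x y') (Nat.lor y x'))

/-- Second mask of the sum of two stored words. -/
def addSnd (x y x' y' : ℕ) : ℕ :=
  Nat.xor (Nat.lor x x') (Nat.xor (Nat.lor x y') (Nat.lor y x'))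

theorem testBit_addFst (x y x' y' j : ℕ) : (addFst x y x' y').testBit j =
    ((y.testBit j || y'.testBit j) ^^
      ((x.testBit j || y'.testBit j) ^^ (y.testBit j || x'.testBit j))) := by
  rw [← Nat.testBit_or, ← Nat.testBit_or, ← Nat.testBit_or, ← Nat.testBit_xor, ← Nat.testBit_xor]
  rfl

theorem testBit_addSnd (x y x' y' j : ℕ) : (addSnd x y x' y').testBit j =
    ((x.testBit j || x'.testBit j) ^^
      ((x.testBit j || y'.testBit j) ^^ (y.testBit j || x'.testBit j))) := by
  rw [← Nat.testBit_or, ← Nat.testBit_or, ← Nat.testBit_or, ← Nat.testBit_xor, ← Nat.testBit_xor]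
  rfl

/-- No position is marked in both masks. -/
def Reduced (m : ℕ × ℕ) : Prop := ∀ j, m.1.testBit j = true → m.2.testBit j = false

/-- Addition has no carries between positions, so this is a truth table in four bits with the
unreduced digits excluded. -/
theorem trit_add {x y x' y' : ℕ} (h : Reduced (x, y)) (h' : Reduced (x', y')) (j : ℕ) :
    (trit (addFst x y x' y', addSnd x y x' y') j : ZMod 3) = trit (x, y) j + trit (x', y') j := by
  have h1 := h j
  have h2 := h' j
  simp only [trit, testBit_addFst, testBit_addSnd] at *
  generalize x.testBit j = a at *
  generalize y.testBit j = b at *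
  generalize x'.testBit j = a' at *
  generalize y'.testBit j = b' at *
  revert a b a' b'
  decide

theorem reduced_add {x y x' y' : ℕ} (h : Reduced (x, y)) (h' : Reduced (x', y')) :
    Reduced (addFst x y x' y', addSnd x y x' y') := by
  intro j
  have h1 := h j
  have h2 := h' j
  simp only [testBit_addFst, testBit_addSnd] at *
  generalize x.testBit j = a at *
  generalize y.testBit j = b at *
  generalize x'.testBit j = a' at *
  generalize y'.testBit j = b' at *
  revert a b a' b'
  decide

theorem maskVec_add {n x y x' y' : ℕ} (h : Reduced (x, y)) (h' : Reduced (x', y')) :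
    maskVec n (addFst x y x' y', addSnd x y x' y') = maskVec n (x, y) + maskVec n (x', y') :=
  Prod.ext (funext fun j => trit_add h h' j) (funext fun j => trit_add h h' (n + j))

theorem reduced_swap {x y : ℕ} (h : Reduced (x, y)) : Reduced (y, x) := by
  intro j
  have h1 := h j
  simp only at *
  generalize x.testBit j = a at *
  generalize y.testBit j = b at *
  revert a b
  decide

theorem maskVec_swap {n x y : ℕ} : maskVec n (y, x) = -maskVec n (x, y) := by
  have : ∀ j, (trit (y, x) j : ZMod 3) = -trit (x, y) j := by
    intro j
    simp only [trit]
    generalize x.testBit j = a at *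
    generalize y.testBit j = b at *
    revert a b
    decide
  exact Prod.ext (funext fun j => this j) (funext fun j => this (n + j))

theorem reduced_of_land {x y : ℕ} (h : x &&& y = 0) : Reduced (x, y) := by
  intro j hj
  have h1 := congrArg (fun z => z.testBit j) h
  simp only [Nat.testBit_and, Nat.zero_testBit] at h1 hj ⊢
  rw [hj] at h1
  simpa using h1

/-- The positions at which a stored vector does not vanish, where `m` is the union of its masks. -/
def maskSupport (n m : ℕ) : ℕ := Nat.mod (Nat.lor m (Nat.shiftRight m n)) (Nat.pow 2 n)

theorem testBit_maskSupport (n m j : ℕ) : (maskSupport n m).testBit j =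
    (decide (j < n) && (m.testBit j || m.testBit (n + j))) := by
  change (((m ||| m >>> n) % 2 ^ n).testBit j) = _
  rw [Nat.testBit_mod_two_pow, Nat.testBit_or, Nat.testBit_shiftRight]

/-- The number of ones among the first `n` binary digits. -/
def popCount (n : ℕ) : ℕ → ℕ :=
  Nat.rec (fun _ => 0) (fun _ ih s => Nat.add (Nat.mod s 2) (ih (Nat.div s 2))) n

theorem popCount_eq (n s : ℕ) : popCount n s = ∑ j : Fin n, (s.testBit j).toNat := by
  induction n generalizing s with
  | zero => rfl
  | succ n ih =>
    have : popCount (n + 1) s = s % 2 + popCount n (s / 2) := rfl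
    rw [this, ih, Fin.sum_univ_succ]
    simp only [Fin.val_zero, Fin.val_succ, Nat.testBit_succ, Nat.testBit_zero]
    congr 1
    rcases Nat.mod_two_eq_zero_or_one s with h | h <;> simp [h]

/-- The number of positions at which a stored vector does not vanish. -/
def maskWeight (n m : ℕ) : ℕ := popCount n (maskSupport n m)

/-- Reducedness matters: a position marked in both masks has digit 3 = 0 but would be counted. -/
theorem maskWeight_eq {n x y : ℕ} (h : Reduced (x, y)) :
    maskWeight n (x ||| y) = wt (maskVec n (x, y)) := by
  rw [maskWeight, popCount_eq, wt_eq_sum]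
  refine Finset.sum_congr rfl fun j _ => ?_
  rw [testBit_maskSupport, decide_eq_true j.2, Bool.true_and]
  have key : ∀ a b a' b' : Bool, (a = true → b = false) → (a' = true → b' = false) →
      ((a || b || (a' || b')) = true ↔
        ((a.toNat + 2 * b.toNat : ℕ) : ZMod 3) ≠ 0 ∨ ((a'.toNat + 2 * b'.toNat : ℕ) : ZMod 3) ≠ 0) := by
    decide
  have h1 := key _ _ _ _ (h j) (h (n + j))
  simp only [← Nat.testBit_or] at h1
  split_ifs with h2
  · rw [h1.mpr h2]
    rfl
  · rw [Bool.eq_false_iff.mpr fun h3 => h2 (h1.mp h3)]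
    rfl

end Qutrit
end

/-! ### Certifying the minimum weight with two information sets -/

noncomputable section
namespace Qutrit

/-- Application of a function to an argument which the kernel evaluates first. -/
def applyEval (x : ℕ) (f : ℕ → Bool) : Bool := Nat.rec (f 0) (fun k _ => f (Nat.succ k)) x

theorem applyEval_eq (x : ℕ) (f : ℕ → Bool) : applyEval x f = f x := by
  cases x <;> rfl

/-- The test that a stored word with the given masks is zero or has weight at least `d`. -/
def weightCheck (n d x y : ℕ) : Bool :=
  applyEval (Nat.lor x y) fun m => applyEval (maskSupport n m) fun s =>
    or (Nat.beq s 0) (Nat.ble d (popCount n s))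

/-- The test that the sum of the stored word with masks `x`, `y` and a systematic encoding of at
most `w` nonzero entries is zero or has weight at least `d`. -/
def searchCheck (n d : ℕ) (rs : List ((ℕ × ℕ) × (ℕ × ℕ))) : ℕ → ℕ → ℕ → Bool :=
  List.rec (fun _ x y => weightCheck n d x y)
    (fun r _ ih w x y => Nat.rec (weightCheck n d x y)
      (fun w _ =>
        let a := r.1.1
        let b := r.1.2
        let s := r.2.1
        let t := r.2.2
        -- Exchanging masks negates a row. The branches are the zero entry, which costs nothing, and
        -- the eight nonzero pairs of coefficients, each costing one unit of `w`.
        let plus := fun x y => and (ih w (addFst x y s t) (addSnd x y s t))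
          (ih w (addFst x y t s) (addSnd x y t s))
        let both := fun x y => and (ih w x y) (plus x y)
        and (ih (Nat.succ w) x y) (and (plus x y)
          (and (both (addFst x y a b) (addSnd x y a b)) (both (addFst x y b a) (addSnd x y b a)))))
      w) rs

theorem searchCheck_zero (n d x y : ℕ) (rs : List ((ℕ × ℕ) × (ℕ × ℕ))) :
    searchCheck n d rs 0 x y = weightCheck n d x y := by
  cases rs <;> rfl

/-- The number of nonzero entries of a vector among the `m` positions from `p` on. -/
def countEntries {n : ℕ} (v : Vec (Fin n)) (p m : ℕ) : ℕ :=
  ∑ q ∈ Finset.Ico p (p + m), if entry v q = 0 then 0 else 1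

theorem countEntries_succ {n : ℕ} (v : Vec (Fin n)) (p m : ℕ) :
    countEntries v p (m + 1) =
      (if entry v p = 0 then 0 else 1) + countEntries v (p + 1) m := by
  rw [countEntries, Finset.sum_eq_sum_Ico_succ_bot (by omega), countEntries]
  congr 3
  omega

theorem weightCheck_spec {n d x y : ℕ} (hr : Reduced (x, y)) (h : weightCheck n d x y = true) :
    maskVec n (x, y) = 0 ∨ d ≤ wt (maskVec n (x, y)) := by
  rw [weightCheck, applyEval_eq, applyEval_eq, Bool.or_eq_true, Nat.beq_eq, Nat.ble_eq] at h
  refine h.imp (fun h => ?_) (fun h => h.trans_eq (maskWeight_eq hr))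
  have key : ∀ j < n, (trit (x, y) j : ZMod 3) = 0 ∧ (trit (x, y) (n + j) : ZMod 3) = 0 := by
    intro j hj
    have h1 := testBit_maskSupport n (x ||| y) j
    have h2 : maskSupport n (x ||| y) = 0 := h
    rw [h2, Nat.zero_testBit, decide_eq_true hj, Bool.true_and, Nat.testBit_or, Nat.testBit_or] at h1
    have h3 := h1.symm
    simp only [Bool.or_eq_false_iff] at h3
    simp [trit, h3]
  exact Prod.ext (funext fun j => (key j j.2).1) (funext fun j => (key j j.2).2)

theorem searchCheck_cons {n d w x y : ℕ} {r : (ℕ × ℕ) × (ℕ × ℕ)} {rs : List ((ℕ × ℕ) × (ℕ × ℕ))}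
    (h : searchCheck n d (r :: rs) (w + 1) x y = true) (hr₁ : Reduced r.1) (hr₂ : Reduced r.2)
    (hxy : Reduced (x, y)) (e : ZMod 3 × ZMod 3) (he : e ≠ 0) :
    ∃ x' y', Reduced (x', y') ∧ searchCheck n d rs w x' y' = true ∧
      maskVec n (x', y') = maskVec n (x, y) + e.1 • maskVec n r.1 + e.2 • maskVec n r.2 := by
  obtain ⟨⟨a, b⟩, ⟨s, t⟩⟩ := r
  have hcases : ∀ z : ZMod 3, z = 0 ∨ z = 1 ∨ z = -1 := by decide
  have plus : ∀ {x y}, Reduced (x, y) →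
      (searchCheck n d rs w (addFst x y s t) (addSnd x y s t) &&
        searchCheck n d rs w (addFst x y t s) (addSnd x y t s)) = true → ∀ f : ZMod 3, f ≠ 0 →
      ∃ x' y', Reduced (x', y') ∧ searchCheck n d rs w x' y' = true ∧
        maskVec n (x', y') = maskVec n (x, y) + f • maskVec n (s, t) := by
    intro x y hxy h f hf
    rw [Bool.and_eq_true] at h
    rcases hcases f with rfl | rfl | rfl
    · exact absurd rfl hf
    · exact ⟨_, _, reduced_add hxy hr₂, h.1, by rw [maskVec_add hxy hr₂, one_smul]⟩
    · exact ⟨_, _, reduced_add hxy (reduced_swap hr₂), h.2, by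
        rw [maskVec_add hxy (reduced_swap hr₂), neg_one_smul, ← maskVec_swap]⟩
  have both : ∀ {x y}, Reduced (x, y) → (searchCheck n d rs w x y &&
      (searchCheck n d rs w (addFst x y s t) (addSnd x y s t) &&
        searchCheck n d rs w (addFst x y t s) (addSnd x y t s))) = true → ∀ f : ZMod 3,
      ∃ x' y', Reduced (x', y') ∧ searchCheck n d rs w x' y' = true ∧
        maskVec n (x', y') = maskVec n (x, y) + f • maskVec n (s, t) := by
    intro x y hxy h f
    rw [Bool.and_eq_true] at h
    by_cases hf : f = 0
    · exact ⟨x, y, hxy, h.1, by rw [hf, zero_smul, add_zero]⟩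
    · exact plus hxy h.2 f hf
  change (_ && (_ && (_ && _))) = true at h
  obtain ⟨h1, h⟩ := Bool.and_eq_true_iff.mp (Bool.and_eq_true_iff.mp h).2
  obtain ⟨h2, h3⟩ := Bool.and_eq_true_iff.mp h
  obtain ⟨e₁, e₂⟩ := e
  rcases hcases e₁ with rfl | rfl | rfl
  · rw [zero_smul, add_zero]
    exact plus hxy h1 e₂ fun h => he (by rw [h]; rfl)
  · rw [one_smul, ← maskVec_add hxy hr₁]
    exact both (reduced_add hxy hr₁) h2 e₂
  · rw [neg_one_smul, ← maskVec_swap, ← maskVec_add hxy (reduced_swap hr₁)]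
    exact both (reduced_add hxy (reduced_swap hr₁)) h3 e₂

theorem searchCheck_skip {n d w x y : ℕ} {r : (ℕ × ℕ) × (ℕ × ℕ)}
    {rs : List ((ℕ × ℕ) × (ℕ × ℕ))} (h : searchCheck n d (r :: rs) w x y = true) :
    searchCheck n d rs w x y = true := by
  cases w with
  | zero => rwa [searchCheck_zero] at h ⊢
  | succ w =>
    change (_ && _) = true at h
    rw [Bool.and_eq_true] at h
    exact h.1

/-- The entries of `v` in the window select a path through the search, spending one unit of the
budget `w` at each nonzero entry. -/
theorem searchCheck_spec {n d : ℕ} {rs : List ((ℕ × ℕ) × (ℕ × ℕ))}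
    (hrs : ∀ r ∈ rs, Reduced r.1 ∧ Reduced r.2) {w x y p : ℕ} {v : Vec (Fin n)}
    (hxy : Reduced (x, y)) (h : searchCheck n d rs w x y = true)
    (hw : countEntries v p rs.length ≤ w) :
    maskVec n (x, y) + systematic rs p v = 0 ∨ d ≤ wt (maskVec n (x, y) + systematic rs p v) := by
  induction rs generalizing w x y p with
  | nil =>
    have : systematic [] p v = 0 := rfl
    rw [this, add_zero]
    exact weightCheck_spec hxy h
  | cons r rs ih =>
    have ih' := @ih fun r hr => hrs r (List.mem_cons_of_mem _ hr)
    rw [List.length_cons, countEntries_succ] at hw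
    rw [systematic_cons]
    by_cases he : entry v p = 0
    · rw [if_pos he, zero_add] at hw
      rw [he, Prod.fst_zero, Prod.snd_zero, zero_smul, zero_smul, add_zero, zero_add]
      exact ih' hxy (searchCheck_skip h) hw
    · rw [if_neg he] at hw
      obtain ⟨w, rfl⟩ : ∃ w', w = w' + 1 := ⟨w - 1, by omega⟩
      obtain ⟨hr₁, hr₂⟩ := hrs r List.mem_cons_self
      obtain ⟨x', y', hxy', h', heq⟩ := searchCheck_cons h hr₁ hr₂ hxy _ he
      rw [← add_assoc, ← add_assoc, ← heq]
      exact ih' hxy' h' (by omega)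

theorem countEntries_zero_right {n : ℕ} (v : Vec (Fin n)) : countEntries v 0 n = wt v := by
  rw [countEntries, zero_add, ← Finset.range_eq_Ico, Finset.sum_range, wt_eq_sum]
  refine Finset.sum_congr rfl fun q _ => ?_
  have : entry v q = 0 ↔ ¬(v.1 q ≠ 0 ∨ v.2 q ≠ 0) := by
    rw [entry, dif_pos q.2]
    simp [Prod.ext_iff]
  by_cases h : entry v q = 0
  · rw [if_pos h, if_neg (this.mp h)]
  · rw [if_neg h, if_pos (not_not.mp fun h' => h (this.mpr h'))]

theorem countEntries_add {n : ℕ} (v : Vec (Fin n)) (p m m' : ℕ) :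
    countEntries v p (m + m') = countEntries v p m + countEntries v (p + m) m' := by
  rw [countEntries, countEntries, countEntries, ← add_assoc,
    Finset.sum_Ico_consecutive _ (by omega) (by omega)]

theorem countEntries_le {n : ℕ} (v : Vec (Fin n)) (p m : ℕ) : countEntries v p m ≤ m := by
  refine (Finset.sum_le_card_nsmul _ _ 1 fun q _ => ?_).trans (by simp)
  split_ifs <;> omega

/-- Two information sets, the first and the last `κ` positions, cover a word twice at no more than
`2 κ - n` positions. -/
theorem countEntries_add_le {n κ : ℕ} (hκ : κ ≤ n) (hn : n ≤ 2 * κ) (v : Vec (Fin n)) :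
    countEntries v 0 κ + countEntries v (n - κ) κ ≤ wt v + (2 * κ - n) := by
  have h1 : countEntries v 0 n = countEntries v 0 (n - κ) + countEntries v (n - κ) κ := by
    have := countEntries_add v 0 (n - κ) κ
    rwa [Nat.sub_add_cancel hκ, zero_add] at this
  have h2 : countEntries v 0 κ =
      countEntries v 0 (n - κ) + countEntries v (n - κ) (2 * κ - n) := by
    have h := countEntries_add v 0 (n - κ) (2 * κ - n)
    have : (n - κ) + (2 * κ - n) = κ := by omega
    rwa [this, zero_add] at h
  have h3 := countEntries_le v (n - κ) (2 * κ - n)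
  rw [countEntries_zero_right] at h1
  omega

/-- An explicit encoder: a symplectic basis of the phase space, stored in pairs of bit masks, and
two systematic generator matrices for the logical operators, for the first and for the last
positions. -/
structure EncoderData where
  /-- images of the operators `X` -/
  X : List (ℕ × ℕ)
  /-- images of the operators `Z` -/
  Z : List (ℕ × ℕ)
  /-- generators that are systematic at the first positions -/
  head : List ((ℕ × ℕ) × (ℕ × ℕ))
  /-- generators that are systematic at the last positions -/
  tail : List ((ℕ × ℕ) × (ℕ × ℕ))

/-- The test that rows are reduced, that a stored vector with index `i` of the basis is systematically
encoded if it is a logical operator, and that words with at most `w` nonzero entries in the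
information set have weight at least `d`. -/
def rowsCheck (n l c d w p : ℕ) (X Z : List (ℕ × ℕ)) (rs : List ((ℕ × ℕ) × (ℕ × ℕ))) : Bool :=
  rs.all (fun r => r.1.1 &&& r.1.2 == 0 && r.2.1 &&& r.2.2 == 0) &&
  allLt l (fun i => systematicCheck n rs p (Z.getD i 0)) &&
  allLt (n - (l + c)) (fun i => systematicCheck n rs p (X.getD (l + c + i) 0) &&
    systematicCheck n rs p (Z.getD (l + c + i) 0)) &&
  searchCheck n d rs w 0 0

/-- The test that the data describe an encoder with `l` ancillas, `c` entangled pairs and distance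
`d`; words are enumerated up to weight `w` in the information sets. -/
def EncoderData.check (E : EncoderData) (n l c d w : ℕ) : Bool :=
  gramCheck n E.X E.Z &&
  (E.head.length == E.tail.length && Nat.ble E.head.length n && Nat.ble n (2 * E.head.length) &&
    -- More than `w` nonzero entries in both windows must force weight at least `d`: either one
    -- window suffices, or both together do after subtracting their overlap.
    (Nat.ble d (w + 1) || Nat.ble (d + (2 * E.head.length - n)) (2 * w + 2))) &&
  rowsCheck n l c d w 0 E.X E.Z E.head &&
  rowsCheck n l c d w (n - E.head.length) E.X E.Z E.tail &&
  ((E.X.getD (l + c) 0).1 &&& (E.X.getD (l + c) 0).2 == 0 &&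
    maskWeight n ((E.X.getD (l + c) 0).1 ||| (E.X.getD (l + c) 0).2) == d)

/-- The position in the list of the basis vectors that belong to an ancilla, an entangled pair, or
an information qutrit. -/
def basisIndex (l c k : ℕ) : Fin l ⊕ (Fin c ⊕ Fin k) → ℕ :=
  Sum.elim (fun i => i) (Sum.elim (fun i => l + i) (fun i => l + c + i))

theorem basisIndex_lt {l c k : ℕ} (j : Fin l ⊕ (Fin c ⊕ Fin k)) :
    basisIndex l c k j < l + c + k := by
  rcases j with i | i | i <;> simp only [basisIndex, Sum.elim_inl, Sum.elim_inr] <;> omega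

theorem basisIndex_injective {l c k : ℕ} : Function.Injective (basisIndex l c k) := by
  rintro (i | i | i) (j | j | j) h <;>
    simp only [basisIndex, Sum.elim_inl, Sum.elim_inr] at h <;>
    first
    | (exfalso; omega)
    | (have : i = j := Fin.ext (by omega)
       rw [this])

theorem rowsCheck_spec {n l c k d w p : ℕ} {X Z : List (ℕ × ℕ)}
    {rs : List ((ℕ × ℕ) × (ℕ × ℕ))} (h : rowsCheck n l c d w p X Z rs = true)
    (hp : p + rs.length ≤ n) (hn : l + c + k = n) (t : Fin l → ZMod 3) (u : Vec (Fin k))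
    (v : Vec (Fin n))
    (hv : v = frameMap (fun j => maskVec n (X.getD (basisIndex l c k j) 0))
      (fun j => maskVec n (Z.getD (basisIndex l c k j) 0))
      (join (0, t) (join (0 : Vec (Fin c)) u)))
    (hw : countEntries v p rs.length ≤ w) : v = 0 ∨ d ≤ wt v := by
  rw [rowsCheck, Bool.and_eq_true, Bool.and_eq_true, Bool.and_eq_true, List.all_eq_true,
    allLt_iff, allLt_iff] at h
  obtain ⟨⟨⟨hr, hZ⟩, hXZ⟩, hs⟩ := h
  have hred : ∀ r ∈ rs, Reduced r.1 ∧ Reduced r.2 := fun r hr' => by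
    have := hr r hr'
    rw [Bool.and_eq_true, beq_iff_eq, beq_iff_eq] at this
    exact ⟨reduced_of_land this.1, reduced_of_land this.2⟩
  -- The encoding is linear, so it fixes `v` once it fixes the generators that occur in `v`. It is
  -- not needed that the rows themselves belong to the code.
  have hsys : systematic rs p v = v := by
    rw [hv, frameMap_apply, map_sum]
    refine Finset.sum_congr rfl fun j _ => ?_
    rw [map_add, map_smul, map_smul]
    rcases j with i | i | i
    · have h2 : basisIndex l c k (Sum.inl i) = i := rfl
      rw [h2, systematicCheck_spec hp (hZ i i.2)]
      have : (join ((0, t) : Vec (Fin l)) (join (0 : Vec (Fin c)) u)).1 (Sum.inl i) = 0 := rfl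
      rw [this, zero_smul, zero_smul]
    · have h1 : (join ((0, t) : Vec (Fin l)) (join (0 : Vec (Fin c)) u)).1
        (Sum.inr (Sum.inl i)) = 0 := rfl
      have h2 : (join ((0, t) : Vec (Fin l)) (join (0 : Vec (Fin c)) u)).2
        (Sum.inr (Sum.inl i)) = 0 := rfl
      rw [h1, h2, zero_smul, zero_smul, zero_smul, zero_smul]
    · have h1 := hXZ i (by omega)
      rw [Bool.and_eq_true] at h1
      have h2 : basisIndex l c k (Sum.inr (Sum.inr i)) = l + c + i := rfl
      rw [h2, systematicCheck_spec hp h1.1, systematicCheck_spec hp h1.2]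
  have h0 : maskVec n (0, 0) = 0 := by
    ext j <;> simp [maskVec, trit]
  have := searchCheck_spec hred (x := 0) (y := 0) (v := v) (fun j hj => by simp at hj) hs hw
  rwa [h0, zero_add, hsys] at this

/-- A nonzero logical operator of weight below `d` escapes both searches, so it has more than `w`
nonzero entries in each window; the numerical condition in `check` excludes this. -/
theorem EncoderData.hasEncoder {E : EncoderData} {n l c k d w : ℕ}
    (h : E.check n l c d w = true) (hn : l + c + k = n) (hk : 0 < k) :
    HasEncoder (Fin n) (Fin l) (Fin c) (Fin k) d (Pi.single ⟨0, hk⟩ 1) := by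
  rw [EncoderData.check] at h
  simp only [Bool.and_eq_true, Bool.or_eq_true, Nat.ble_eq, beq_iff_eq] at h
  obtain ⟨⟨⟨⟨hG, ⟨⟨hlen, hle⟩, hle2⟩, hd⟩, hhead⟩, htail⟩, hred, hwt⟩ := h
  let X : Fin l ⊕ (Fin c ⊕ Fin k) → Vec (Fin n) :=
    fun j => maskVec n (E.X.getD (basisIndex l c k j) 0)
  let Z : Fin l ⊕ (Fin c ⊕ Fin k) → Vec (Fin n) :=
    fun j => maskVec n (E.Z.getD (basisIndex l c k j) 0)
  have hlt : ∀ j : Fin l ⊕ (Fin c ⊕ Fin k), basisIndex l c k j < n := fun j =>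
    (basisIndex_lt j).trans_eq hn
  have hsymp : ∀ u v, symp (frameMap X Z u) (frameMap X Z v) = symp u v :=
    symp_frameMap (fun i j => (gramCheck_spec hG (hlt i) (hlt j)).1)
      (fun i j => (gramCheck_spec hG (hlt i) (hlt j)).2.1)
      (fun i j => by
        rw [(gramCheck_spec hG (hlt i) (hlt j)).2.2]
        simp only [basisIndex_injective.eq_iff])
  let enc : Vec (Fin l) × Vec (Fin c) × Vec (Fin k) →ₗ[ZMod 3] Vec (Fin n) :=
    frameMap X Z ∘ₗ joinMap _ _ ∘ₗ LinearMap.prodMap LinearMap.id (joinMap _ _)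
  have henc : IsEncoder enc := fun u v => by
    change symp (frameMap X Z (join u.1 (join u.2.1 u.2.2)))
      (frameMap X Z (join v.1 (join v.2.1 v.2.2))) = _
    rw [hsymp, symp_join, symp_join, add_assoc]
  refine ⟨by simp only [Fintype.card_fin, hn], enc, henc, fun t u hu => ?_, 0, ?_⟩
  · have hne : logical enc t u ≠ 0 := fun h0 => hu <| by
      have h1 := henc.injective (h0.trans (map_zero enc).symm)
      exact congrArg (fun x => x.2.2) h1
    by_contra hlow
    have h1 := rowsCheck_spec hhead (by omega) hn t u (logical enc t u) rfl
    have h2 := rowsCheck_spec htail (by omega) hn t u (logical enc t u) rfl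
    have h3 := countEntries_add_le hle hle2 (logical enc t u)
    rw [← hlen] at h2
    have h4 : w < countEntries (logical enc t u) 0 E.head.length := by
      by_contra h'
      exact (h1 (by omega)).elim hne hlow
    have h5 : w < countEntries (logical enc t u) (n - E.head.length) E.head.length := by
      by_contra h'
      exact (h2 (by omega)).elim hne hlow
    have h6 : countEntries (logical enc t u) 0 E.head.length ≤ wt (logical enc t u) := by
      have h7 := countEntries_add (logical enc t u) 0 E.head.length (n - E.head.length)
      rw [Nat.add_sub_cancel' hle, countEntries_zero_right] at h7
      omega
    omega
  -- The distance is attained, with `t = 0`, by the image of X on the first information qutrit, the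
  -- stored vector with index `l + c`.
  · rw [← hwt, maskWeight_eq (reduced_of_land hred)]
    congr 1
    change frameMap X Z (join 0 (join 0 (Pi.single ⟨0, hk⟩ 1, 0))) = _
    rw [frameMap_apply, Fintype.sum_sum_type, Fintype.sum_sum_type]
    simp [join, Pi.single_apply, X, basisIndex]

end Qutrit
end

/-! ### Explicit encoders -/

noncomputable section
namespace Qutrit

/-- An encoder of a code with parameters `[[5, 1, 3; 0]]₃`. -/
def encoder513 : EncoderData where
  X := [(0, 32), (4, 24), (26, 36), (12, 416), (552, 256)]
  Z := [(33, 720), (370, 128), (612, 272), (776, 176), (770, 128)]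
  head := [((17, 264), (552, 256)), ((282, 512), (848, 8)), ((20, 768), (664, 0))]
  tail := [((6, 65), (194, 32)), ((41, 64), (290, 1)), ((19, 96), (611, 0))]

theorem encoder513_check : encoder513.check 5 4 0 3 1 = true := by decide +kernel

/-- An encoder of a code with parameters `[[6, 1, 4; 1]]₃`. -/
def encoder614 : EncoderData where
  X := [(1, 180), (184, 1), (145, 832), (777, 1076), (64, 14), (1144, 0)]
  Z := [(2049, 1328), (578, 2208), (84, 3104), (2008, 2080), (129, 56), (1152, 2049)]
  head := [((17, 3584), (1144, 0)), ((34, 1032), (2192, 512)), ((1060, 2056), (2336, 528))]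
  tail := [((74, 389), (646, 321)), ((144, 322), (1029, 130)), ((226, 256), (2180, 3))]

theorem encoder614_check : encoder614.check 6 4 1 4 1 = true := by decide +kernel

/-- An encoder of a code with parameters `[[8, 2, 5; 2]]₃`. -/
def encoder825 : EncoderData where
  X := [(8208, 1543), (9581, 2), (8216, 1607), (9956, 18458), (128, 125), (1608, 432), (8448,
    32880), (4337, 61184)]
  Z := [(6801, 17472), (38018, 848), (2132, 768), (55368, 1408), (104, 771), (8201, 388), (23040,
    33794), (9460, 51456)]
  head := [((28705, 128), (8448, 32880)), ((32786, 12512), (4656, 57472)), ((16548, 45120),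
    (42160, 16448)), ((8296, 53392), (26832, 36896))]
  tail := [((3354, 5), (6656, 1293)), ((291, 2060), (8968, 3073)), ((321, 1550), (16646, 3585)),
    ((2688, 270), (32769, 3594))]

theorem encoder825_check : encoder825.check 8 4 2 5 2 = true := by decide +kernel

/-- An encoder of a code with parameters `[[6, 2, 4; 2]]₃`. -/
def encoder624 : EncoderData where
  X := [(2, 1485), (96, 13), (90, 1), (276, 202), (64, 1576), (2858, 1153)]
  Z := [(3077, 10), (688, 320), (178, 8), (1033, 196), (321, 2560), (1344, 2092)]
  head := [((2561, 24), (64, 1576)), ((1058, 2568), (2216, 528)), ((564, 3080), (3376, 520))]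
  tail := [((329, 134), (578, 389)), ((470, 0), (1408, 7)), ((163, 256), (2244, 2))]

theorem encoder624_check : encoder624.check 6 2 2 4 1 = true := by decide +kernel

/-- An encoder of a code with parameters `[[10, 2, 4; 0]]₃`. -/
def encoder1024 : EncoderData where
  X := [(4545, 8246), (1064, 2386), (6187, 16720), (8710, 16864), (265424, 13095), (550, 267353),
    (5265, 8494), (29761, 133300), (271104, 131200), (549634, 196737)]
  Z := [(9601, 510464), (606722, 264576), (288004, 756224), (527368, 361216), (148240, 566272),
    (41888, 720896), (634432, 128), (700416, 16384), (589824, 34817), (327809, 665860)]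
  head := [((393729, 524480), (525824, 196992)), ((65986, 262656), (461056, 524352)), ((851972,
    131456), (4224, 394048)), ((131336, 786560), (271104, 131200)), ((786896, 196608), (475328,
    768)), ((852960, 131072), (1015936, 832))]
  tail := [((1045, 2050), (21506, 2049)), ((5152, 8200), (32776, 8197)), ((72, 2055), (73730,
    7168)), ((7308, 8194), (143368, 2055)), ((4352, 11264), (262155, 4)), ((6669, 9216), (537609,
    6))]

theorem encoder1024_check : encoder1024.check 10 8 0 4 2 = true := by decide +kernel

/-- An encoder of a code with parameters `[[6, 2, 3; 0]]₃`. -/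
def encoder623 : EncoderData where
  X := [(361, 6), (274, 201), (12, 675), (1150, 513), (1088, 2064), (530, 1088)]
  Z := [(1, 3720), (2506, 0), (1060, 448), (48, 2944), (1153, 2048), (132, 2048)]
  head := [((1041, 32), (1088, 2064)), ((1026, 2080), (160, 2064)), ((20, 32), (1280, 2048)), ((8,
    2064), (544, 1024))]
  tail := [((68, 2), (256, 129)), ((9, 2), (576, 128)), ((145, 64), (1089, 2)), ((161, 2), (2112,
    130))]

theorem encoder623_check : encoder623.check 6 4 0 3 2 = true := by decide +kernel

/-- An encoder of a code with parameters `[[8, 4, 3; 0]]₃`. -/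
def encoder843 : EncoderData where
  X := [(8852, 321), (264, 13523), (12816, 17605), (17212, 2115), (384, 16384), (36865, 0),
    (49155, 0), (49161, 2434)]
  Z := [(10281, 34368), (59402, 5088), (21068, 33152), (21840, 34848), (34816, 4100), (0, 4500),
    (32768, 4160), (2050, 32)]
  head := [((1, 32832), (384, 16384)), ((16450, 32768), (17024, 64)), ((32900, 16448), (33856,
    16512)), ((136, 32832), (34944, 16384)), ((16, 16512), (4160, 32768)), ((224, 0), (57344, 0))]
  tail := [((4, 515), (1026, 768)), ((11, 512), (2818, 0)), ((18, 769), (4611, 256)), ((800, 0),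
    (8192, 3)), ((578, 257), (16897, 258)), ((641, 2), (33024, 514))]

theorem encoder843_check : encoder843.check 8 4 0 3 2 = true := by decide +kernel

/-- An encoder of a code with parameters `[[10, 6, 3; 0]]₃`. -/
def encoder1063 : EncoderData where
  X := [(48, 8), (0, 56), (20, 8), (60, 0), (787712, 512), (524289, 327680), (524293, 393218),
    (524300, 1), (22, 0), (262177, 20)]
  Z := [(582977, 198688), (112386, 264272), (17540, 625488), (495624, 542368), (196608, 524290),
    (787008, 1280), (131714, 1280), (722690, 192), (527745, 262658), (328898, 525)]
  head := [((525057, 262144), (787712, 512)), ((258, 786432), (264960, 0)), ((262660, 0), (528384,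
    256)), ((262408, 524288), (270848, 256)), ((524304, 768), (16384, 786944)), ((288, 512),
    (294912, 524288)), ((64, 786432), (66304, 0)), ((524928, 256), (655360, 262656))]
  tail := [((2055, 0), (7168, 2)), ((3080, 0), (8192, 3)), ((16, 2049), (16386, 1024)), ((33,
    3072), (33795, 0)), ((65, 2048), (66562, 0)), ((131, 1024), (134145, 0)), ((259, 2048),
    (265218, 0)), ((2562, 1025), (526337, 1026))]

theorem encoder1063_check : encoder1063.check 10 4 0 3 2 = true := by decide +kernel

/-- An encoder of a code with parameters `[[12, 2, 5; 0]]₃`. -/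
def encoder1225 : EncoderData where
  X := [(4235, 18292), (5, 2480), (708, 32792), (90353, 2308), (124488, 2455), (168456, 92291),
    (65756, 936193), (67660, 1487154), (1182208, 2123227), (594960, 7375104), (5120, 13633664),
    (6291458, 9535489)]
  Z := [(1118721, 679936), (4440066, 11010048), (41476, 612352), (1079304, 11305472), (139280,
    6918144), (32, 11897344), (1704000, 8404992), (655488, 4544512), (16589056, 164352), (787456,
    8513536), (3670017, 12648448), (8196, 8257536)]
  head := [((8912897, 4197632), (5120, 13633664)), ((9437186, 2688), (8192, 11012352)), ((3147396,
    524288), (6832256, 768)), ((7864328, 8390784), (34816, 8914816)), ((13631504, 2816), (65536,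
    11537664)), ((4194336, 8913536), (133248, 2622464)), ((5243968, 10488576), (4459008,
    11535616))]
  tail := [((65588, 12299), (212995, 45072)), ((49241, 73730), (364562, 8204)), ((4244, 9),
    (606208, 36865)), ((65796, 36880), (1064969, 65552)), ((107010, 4104), (2105345, 32794)),
    ((74769, 36872), (4263945, 32786)), ((104451, 12), (8400896, 49177))]

theorem encoder1225_check : encoder1225.check 12 10 0 5 3 = true := by decide +kernel

/-- An encoder of a code with parameters `[[14, 2, 6; 0]]₃`. -/
def encoder1426 : EncoderData where
  X := [(16256, 16384), (2122890, 35173), (6229, 2130216), (185362, 68164), (7180, 139696),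
    (558336, 1249814), (218499, 2097744), (10510561, 267286), (344134, 10496169), (13893883,
    208128), (50763797, 1132106), (16791704, 112345378), (201355264, 20972032), (80834563,
    33554944)]
  Z := [(58769409, 142082112), (74514434, 185106496), (20086788, 76103744), (143982600, 36323392),
    (47317008, 218382400), (204210208, 30425152), (202915968, 6758400), (71729408, 143745024),
    (78774784, 155754496), (86574080, 176316416), (36456448, 152150016), (136548352, 102506496),
    (21954561, 210796544), (139620352, 17564165)]
  head := [((8400897, 201327872), (201355264, 20972032)), ((113248770, 16782592), (41976832,
    88087296)), ((226497540, 33565184), (83953664, 176174592)), ((67109640, 12593152), (12714752,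
    167776256)), ((134228240, 25167360), (172230144, 25174016)), ((50334752, 213917952),
    (50868992, 138415104)), ((4203840, 100669440), (156243968, 100663552)), ((16256, 0),
    (266338304, 0))]
  tail := [((127, 0), (2080768, 0)), ((524422, 98345), (2195462, 671776)), ((196897, 835596),
    (4735027, 196620)), ((16920, 393253), (8781848, 606209)), ((33797, 786480), (16859184,
    786434)), ((444437, 65546), (33898500, 163867)), ((888874, 131092), (67797000, 327734)),
    ((270376, 49155), (134873091, 49168))]

theorem encoder1426_check : encoder1426.check 14 12 0 6 3 = true := by decide +kernel

end Qutrit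
end

/-! ### Assembling the five codes -/

noncomputable section
namespace Qutrit

theorem existsEAQECCNe_of_hasEncoder {n k d c m k' d' : ℕ} {ν lam γ lam' γ' : Type} [Fintype ν]
    [DecidableEq ν] [Fintype lam] [DecidableEq lam] [Fintype γ] [DecidableEq γ] [Fintype lam']
    [DecidableEq lam'] [Fintype γ'] [DecidableEq γ'] [IsEmpty γ'] {a : Fin k → ZMod 3}
    {a' : Fin k' → ZMod 3} (h : HasEncoder ν lam γ (Fin k) d a)
    (h' : HasEncoder (Fin m) lam' γ' (Fin k') d' a') (ha : a ≠ 0) (ha' : a' ≠ 0)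
    (hn : Fintype.card ν = n) (hc : Fintype.card γ = c) (hk : c ≤ k') :
    ExistsEAQECCNe n k d c m k' d' := by
  obtain ⟨S, hS⟩ := (h.reindex (Fintype.equivFinOfCardEq hn).symm
    (Fintype.equivFinOfCardEq hc).symm).exists_eaStabilizes ha
  obtain ⟨S', hS'⟩ := h'.exists_stabilizes ha'
  exact ⟨S, S', hS, hS', hk⟩

theorem single_one_ne_zero {k : ℕ} (i : Fin k) : (Pi.single i 1 : Fin k → ZMod 3) ≠ 0 := by
  rw [Ne, Pi.single_eq_zero_iff]
  exact one_ne_zero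

/-- A code with parameters `[[26, 2, 11; 2]]₃`, glued from a `[[12, 2, 5]]₃` code and a
`[[14, 2, 6]]₃` code. -/
theorem hasEncoder_26_2_11 : HasEncoder (Fin 12 ⊕ Fin 14) (Fin 10 ⊕ Fin 12)
    ((Fin 0 ⊕ Fin 0) ⊕ Fin 2) (Fin 2) 11 (Pi.single ⟨0, two_pos⟩ 1) :=
  (encoder1225.hasEncoder encoder1225_check rfl two_pos).glue
    (encoder1426.hasEncoder encoder1426_check rfl two_pos)

theorem hasEncoder_6_2_3 :
    HasEncoder (Fin 6) (Fin 4) (Fin 0) (Fin 2) 3 (Pi.single ⟨0, two_pos⟩ 1) :=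
  encoder623.hasEncoder encoder623_check rfl two_pos

theorem hasEncoder_8_4_3 :
    HasEncoder (Fin 8) (Fin 4) (Fin 0) (Fin 4) 3 (Pi.single ⟨0, four_pos⟩ 1) :=
  encoder843.hasEncoder encoder843_check rfl four_pos

theorem hasEncoder_10_6_3 :
    HasEncoder (Fin 10) (Fin 4) (Fin 0) (Fin 6) 3 (Pi.single ⟨0, Nat.succ_pos 5⟩ 1) :=
  encoder1063.hasEncoder encoder1063_check rfl (Nat.succ_pos 5)

theorem hasEncoder_8_2_5 :
    HasEncoder (Fin 8) (Fin 4) (Fin 2) (Fin 2) 5 (Pi.single ⟨0, two_pos⟩ 1) :=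
  encoder825.hasEncoder encoder825_check rfl two_pos

theorem hasEncoder_10_2_4 :
    HasEncoder (Fin 10) (Fin 8) (Fin 0) (Fin 2) 4 (Pi.single ⟨0, two_pos⟩ 1) :=
  encoder1024.hasEncoder encoder1024_check rfl two_pos

/-- Length 5 + 6, distance 3 + 4, ebits 0 + 1 and one more from gluing. -/
theorem existsEAQECCNe_11_1_7 : ExistsEAQECCNe 11 1 7 2 6 2 3 :=
  existsEAQECCNe_of_hasEncoder
    ((encoder513.hasEncoder (k := 1) encoder513_check rfl one_pos).glue
      (encoder614.hasEncoder encoder614_check rfl one_pos))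
    hasEncoder_6_2_3 (single_one_ne_zero _) (single_one_ne_zero _) (by simp) (by simp) le_rfl

theorem existsEAQECCNe_26_2_11 : ExistsEAQECCNe 26 2 11 2 6 2 3 :=
  existsEAQECCNe_of_hasEncoder hasEncoder_26_2_11 hasEncoder_6_2_3 (single_one_ne_zero _)
    (single_one_ne_zero _) (by simp) (by simp) le_rfl

/-- Two bare ebit halves raise both the length and the number of ebits by 2. -/
theorem existsEAQECCNe_28_2_11 : ExistsEAQECCNe 28 2 11 4 8 4 3 :=
  existsEAQECCNe_of_hasEncoder (hasEncoder_26_2_11.append (ι := Fin 2)) hasEncoder_8_4_3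
    (single_one_ne_zero _) (single_one_ne_zero _) (by simp) (by simp) le_rfl

/-- Length 8 + 6, distance 5 + 4, ebits 2 + 2 and two more from gluing. -/
theorem existsEAQECCNe_14_2_9 : ExistsEAQECCNe 14 2 9 6 10 6 3 :=
  existsEAQECCNe_of_hasEncoder
    (hasEncoder_8_2_5.glue (encoder624.hasEncoder encoder624_check rfl two_pos))
    hasEncoder_10_6_3 (single_one_ne_zero _) (single_one_ne_zero _) (by simp) (by simp) le_rfl

/-- Length 8 + 10 + 10, distance 5 + 4 + 4, ebits 2 + 0 + 0 and two more from each gluing. -/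
theorem existsEAQECCNe_28_2_13 : ExistsEAQECCNe 28 2 13 6 10 6 3 :=
  existsEAQECCNe_of_hasEncoder
    ((hasEncoder_8_2_5.glue hasEncoder_10_2_4).glue hasEncoder_10_2_4)
    hasEncoder_10_6_3 (single_one_ne_zero _) (single_one_ne_zero _) (by simp) (by simp) le_rfl

end Qutrit
end

theorem corollary4p4 :
    Qutrit.ExistsEAQECCNe 11 1 7 2 6 2 3 ∧
    Qutrit.ExistsEAQECCNe 26 2 11 2 6 2 3 ∧
    Qutrit.ExistsEAQECCNe 28 2 11 4 8 4 3 ∧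
    Qutrit.ExistsEAQECCNe 14 2 9 6 10 6 3 ∧
    Qutrit.ExistsEAQECCNe 28 2 13 6 10 6 3 :=
  ⟨Qutrit.existsEAQECCNe_11_1_7, Qutrit.existsEAQECCNe_26_2_11, Qutrit.existsEAQECCNe_28_2_11,
    Qutrit.existsEAQECCNe_14_2_9, Qutrit.existsEAQECCNe_28_2_13⟩
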